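/- For $0\le k\le n$ let $G(n,k)$ be the Grassmannian of $k$-dimensional linear subspaces of Euclidean space $\mathbb R^n$, and let $dg$ be its $O_n(\mathbb R)$-invariant Borel probability measure (the image of the Haar probability measure of $O_n(\mathbb R)$ under $U\mapsto Ug_0$, for any $g_0\in G(n,k)$). For $A\in GL_n(\mathbb R)$ and $g\in G(n,k)$ write $A_\#g=A(g)\in G(n,k)$, and let $|\det A|_g|$ be the modulus of the determinant of the linear map $A|_g\colon g\to A(g)$ with respect to orthonormal bases of $g$ and $A(g)$, i.e. $|\det A|_g|=\sqrt{\det\big((A|_g)^{T}(A|_g)\big)}$. Put $\log^+x=\max(0,\log x)$. A Borel measure $\mu$ on $GL_n(\mathbb R)$ is called orthogonally invariant if it is invariant under left multiplication $A\mapsto UA$ by every $U\in O_n(\mathbb R)$. **Theorem.** For every $n$ there is a constant $c_n>0$, depending only on $n$, such that for every $0\le k\le n$ and every orthogonally invariant Borel probability measure $\mu$ on $GL_n(\mathbb R)$, $$ \int_{GL_n(\mathbb R)}\Big[\sup_{\substack{g\in G(n,k)\\ A_\#g=g}}\log^+|\det A|_g|\Big]\,d\mu(A)\;\ge\; c_n\int_{GL_n(\mathbb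 R)}\int_{G(n,k)}\log^+|\det A|_g|\,dg\,d\mu(A), $$ where the supremum is $0$ if no $g\in G(n,k)$ satisfies $A_\#g=g$, and both sides are taken in $[0,\infty]$. -/

import Mathlib

open MeasureTheory Matrix Real
open scoped ENNReal NNReal

noncomputable section

namespace OrthInv

/-- `ℝⁿ` with its Euclidean structure. -/
abbrev E (n : ℕ) : Type := EuclideanSpace ℝ (Fin n)

/-- The orthogonal group `O_n(ℝ)`. -/
abbrev O (n : ℕ) : Type := Matrix.orthogonalGroup (Fin n) ℝ

/-- `GL_n(ℝ)` carries its Borel σ-algebra. -/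
instance instMeasurableSpaceGL (n : ℕ) : MeasurableSpace (GL (Fin n) ℝ) := borel _

instance instBorelSpaceGL (n : ℕ) : BorelSpace (GL (Fin n) ℝ) := ⟨rfl⟩

/-- `O_n(ℝ)` carries its Borel σ-algebra. -/
instance instMeasurableSpaceO (n : ℕ) : MeasurableSpace (O n) := borel _

instance instBorelSpaceO (n : ℕ) : BorelSpace (O n) := ⟨rfl⟩

instance instCompactSpaceO (n : ℕ) : CompactSpace (O n) := by
  have hc : IsCompact (Set.pi Set.univ fun _ : Fin n =>
      Set.pi Set.univ fun _ : Fin n => Metric.closedBall (0 : ℝ) 1) :=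
    isCompact_univ_pi fun _ => isCompact_univ_pi fun _ => isCompact_closedBall _ _
  have hcl : IsClosed ((Matrix.orthogonalGroup (Fin n) ℝ : Submonoid (Matrix (Fin n) (Fin n) ℝ)) :
      Set (Matrix (Fin n) (Fin n) ℝ)) := by
    have h : ((Matrix.orthogonalGroup (Fin n) ℝ : Submonoid (Matrix (Fin n) (Fin n) ℝ)) :
        Set (Matrix (Fin n) (Fin n) ℝ)) = {M | M * star M = 1} := by
      ext M; exact Matrix.mem_orthogonalGroup_iff (Fin n) ℝ
    rw [h]
    exact isClosed_eq (by fun_prop) continuous_const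
  refine isCompact_iff_compactSpace.mp (IsCompact.of_isClosed_subset hc hcl ?_)
  intro M hM i _ j _
  simpa using entry_norm_bound_of_unitary hM i j

/-- The inclusion `O_n(ℝ) ⊆ GL_n(ℝ)`. -/
def O.toGL {n : ℕ} : O n →* GL (Fin n) ℝ := Unitary.toUnits

/-- The linear automorphism `x ↦ A x` of `ℝⁿ`, as a linear map. -/
def euclMap {n : ℕ} (A : GL (Fin n) ℝ) : E n →ₗ[ℝ] E n :=
  (Matrix.toEuclideanCLM (𝕜 := ℝ) (A : Matrix (Fin n) (Fin n) ℝ) : E n →L[ℝ] E n)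

lemma euclMap_one {n : ℕ} : euclMap (1 : GL (Fin n) ℝ) = LinearMap.id := by
  ext; simp [euclMap]

lemma euclMap_mul {n : ℕ} (A B : GL (Fin n) ℝ) : euclMap (A * B) = euclMap A ∘ₗ euclMap B := by
  ext; simp [euclMap]

lemma euclMap_injective {n : ℕ} (A : GL (Fin n) ℝ) : Function.Injective (euclMap A) := by
  have h : euclMap A⁻¹ ∘ₗ euclMap A = LinearMap.id := by
    rw [← euclMap_mul, inv_mul_cancel, euclMap_one]
  intro x y hxy
  simpa [h] using (show (euclMap A⁻¹ ∘ₗ euclMap A) x = (euclMap A⁻¹ ∘ₗ euclMap A) y by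
    simp [hxy])

/-- The Grassmannian `G(n,k)` of `k`-dimensional linear subspaces of `ℝⁿ`. -/
def Grass (n k : ℕ) : Type := {g : Submodule ℝ (E n) // Module.finrank ℝ g = k}

/-- The natural action `A_# g = A(g)` of `GL_n(ℝ)` on `G(n,k)`. -/
instance instMulActionGrass (n k : ℕ) : MulAction (GL (Fin n) ℝ) (Grass n k) where
  smul A g := ⟨g.1.map (euclMap A),
    (LinearEquiv.finrank_eq
      (Submodule.equivMapOfInjective _ (euclMap_injective A) g.1)).symm.trans g.2⟩
  one_smul g := Subtype.ext (by
    change g.1.map (euclMap 1) = g.1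
    rw [euclMap_one, Submodule.map_id])
  mul_smul A B g := Subtype.ext (by
    change g.1.map (euclMap (A * B)) = (g.1.map (euclMap B)).map (euclMap A)
    rw [euclMap_mul, Submodule.map_comp])

/-- The usual topology of `G(n,k)`: a subspace is identified with the orthogonal projection
onto it. -/
instance instTopologicalSpaceGrass (n k : ℕ) : TopologicalSpace (Grass n k) :=
  TopologicalSpace.induced (fun g => g.1.starProjection) inferInstance

/-- `G(n,k)` carries its Borel σ-algebra. -/
instance instMeasurableSpaceGrass (n k : ℕ) : MeasurableSpace (Grass n k) := borel _

instance instBorelSpaceGrass (n k : ℕ) : BorelSpace (Grass n k) := ⟨rfl⟩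

/-- The coordinate subspace spanned by the first `k` standard basis vectors. -/
def Grass.base {n k : ℕ} (h : k ≤ n) : Grass n k :=
  ⟨Submodule.span ℝ (Set.range fun i : Fin k => EuclideanSpace.single (Fin.castLE h i) (1 : ℝ)), by
    have hli : LinearIndependent ℝ
        (fun i : Fin k => EuclideanSpace.single (Fin.castLE h i) (1 : ℝ)) := by
      have := (EuclideanSpace.basisFun (Fin n) ℝ).toBasis.linearIndependent.comp
        (Fin.castLE h) (Fin.castLE_injective h)
      simpa [Function.comp_def] using this
    simpa using finrank_span_eq_card hli⟩

/-- The Haar probability measure of `O_n(ℝ)`. -/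
def haarO (n : ℕ) : Measure (O n) := Measure.haarMeasure ⊤

instance instIsProbabilityMeasureHaarO (n : ℕ) : IsProbabilityMeasure (haarO n) :=
  ⟨by simpa [haarO] using Measure.haarMeasure_self (K₀ := (⊤ : TopologicalSpace.PositiveCompacts (O n)))⟩

/-- The orbit map of `O_n(ℝ)` on the Grassmannian is continuous. -/
lemma continuous_orbit {n k : ℕ} (g : Grass n k) :
    Continuous fun U : O n => O.toGL U • g := by
  refine continuous_induced_rng.mpr ?_
  have key : ∀ U : O n, (O.toGL U • g).1.starProjection =
      (Matrix.toEuclideanCLM (𝕜 := ℝ) (U : Matrix (Fin n) (Fin n) ℝ)) ∘L g.1.starProjection ∘L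
        (Matrix.toEuclideanCLM (𝕜 := ℝ) (star (U : Matrix (Fin n) (Fin n) ℝ))) := by
    intro U
    let V : unitary (E n →L[ℝ] E n) :=
      ⟨Matrix.toEuclideanCLM (𝕜 := ℝ) (U : Matrix (Fin n) (Fin n) ℝ),
        Unitary.map_mem (Matrix.toEuclideanCLM (𝕜 := ℝ) (n := Fin n)) U.2⟩
    let f : E n ≃ₗᵢ[ℝ] E n := Unitary.linearIsometryEquiv V
    have hmap : (O.toGL U • g).1 = g.1.map (f.toLinearEquiv : E n →ₗ[ℝ] E n) := rfl
    ext1 x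
    have h := Submodule.starProjection_map_apply f g.1 x
    have hs : f.symm x =
        Matrix.toEuclideanCLM (𝕜 := ℝ) (star (U : Matrix (Fin n) (Fin n) ℝ)) x := by
      rw [map_star]; rfl
    rw [hs] at h
    exact h
  have hc : Continuous fun M : Matrix (Fin n) (Fin n) ℝ => Matrix.toEuclideanCLM (𝕜 := ℝ) M :=
    LinearMap.continuous_of_finiteDimensional
      (Matrix.toEuclideanCLM (𝕜 := ℝ) (n := Fin n)).toAlgEquiv.toLinearMap
  have : ((fun g : Grass n k => g.1.starProjection) ∘ fun U : O n => O.toGL U • g) = fun U : O n =>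
      (Matrix.toEuclideanCLM (𝕜 := ℝ) (U : Matrix (Fin n) (Fin n) ℝ)) ∘L g.1.starProjection ∘L
        (Matrix.toEuclideanCLM (𝕜 := ℝ) (star (U : Matrix (Fin n) (Fin n) ℝ))) := funext key
  rw [this]
  exact (hc.comp continuous_subtype_val).clm_comp (continuous_const.clm_comp
    (hc.comp (continuous_star.comp continuous_subtype_val)))

/-- The `O_n(ℝ)`-invariant probability measure `dg` of `G(n,k)`, that is the image of the Haar
probability measure of `O_n(ℝ)` under the (transitive) action. -/
def grassMeasure {n k : ℕ} (h : k ≤ n) : Measure (Grass n k) :=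
  (haarO n).map fun U => O.toGL U • Grass.base h

instance instIsProbabilityMeasureGrass {n k : ℕ} (h : k ≤ n) :
    IsProbabilityMeasure (grassMeasure h) :=
  Measure.isProbabilityMeasure_map (continuous_orbit _).measurable.aemeasurable

/-- `|det A|_g|`: the factor by which `A` multiplies `k`-dimensional volume on `g`, that is the
modulus of the determinant of `A|_g : g → A(g)` in orthonormal bases of `g` and `A(g)`, written as
`√det((A|_g)ᵀ (A|_g))`. For `A(g) = g` it is the modulus of the determinant of the
endomorphism `A|_g` of `g`. -/
def absDet {n k : ℕ} (A : GL (Fin n) ℝ) (g : Grass n k) : ℝ :=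
  √(LinearMap.det (LinearMap.adjoint ((euclMap A).domRestrict g.1) ∘ₗ
    (euclMap A).domRestrict g.1))

/-- `log⁺ |det A|_g|`, as an element of `[0,∞]`. -/
def logPlusDet {n k : ℕ} (A : GL (Fin n) ℝ) (g : Grass n k) : ℝ≥0∞ :=
  ENNReal.ofReal (Real.posLog (absDet A g))

/-- A measure on `GL_n(ℝ)` is orthogonally invariant if it is invariant under left multiplication
by orthogonal matrices. -/
def IsOrthogonallyInvariant {n : ℕ} (μ : Measure (GL (Fin n) ℝ)) : Prop :=
  ∀ U : O n, μ.map (fun A => O.toGL U * A) = μ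

end OrthInv

end

/-! Left invariance of `μ` and Tonelli reduce the theorem to a single orbit: for fixed `A`, compare
the average of `log⁺ |det A|_g|` over planes `g` with the average over `U` of the supremum belonging
to `U * A`. Since the volume factor of `U * A` on `g` does not depend on `U`, the layer-cake formula
turns this into a statement on open sets `Ω` of `k`-planes: the measure of `Ω` is at most `N` times
the probability that `U * A` preserves some plane in `Ω`, with `N` independent of `A` and `Ω`
(`measure_frameProj_mem_le`).

Near a plane `g₀`, orthonormal frames adapted to `g₀` and `A(g₀)` make `A` block upper triangular,
`D + N` with `D` positive diagonal (`exists_block_qr`). Take `U` which in these frames is close to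
the reflection that is `1` on the coordinate plane and `-1` on its complement. Looking for an
invariant plane of `U * A` as a graph over `g₀` gives a Riccati equation whose linear part is `X * D
+ D * X`. The plus sign comes from the reflection and makes this operator invertible with bounds
independent of `D`, so no spectral gap is needed. Hence if `U * A` moves `g₀` by at most `r / 16`,
with `r` small, it has an invariant plane within `r` of `g₀` (`exists_shear_blockTriangular`,
`exists_split_invariant_near`). Relative to `D`, the map is almost positive on this plane and almost
negative on the quotient, and at most one invariant plane has this property
(`IsSplitInvariant.unique`).

To globalise, choose disjoint balls in `Ω` by Vitali's lemma. By uniqueness the sets of good `U` for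
different balls are disjoint. Each has measure comparable to that of the fivefold ball, because only
the displacement of the plane is constrained at scale `r` (`exists_measure_le_nearRefl`). Summation
gives the bound. -/

noncomputable section

namespace OrthInv

/-! ### The Frobenius norm and orthogonal projections -/

section Frobenius

open scoped Matrix.Norms.Frobenius

variable {ι : Type*} [Fintype ι] [DecidableEq ι]

lemma frobenius_norm_sq (M : Matrix ι ι ℝ) : ‖M‖ ^ 2 = ∑ i, ∑ j, M i j ^ 2 := by
  have h : 0 ≤ ∑ i, ∑ j, ‖M i j‖ ^ 2 := by positivity
  rw [frobenius_norm_def, ← Real.sqrt_eq_rpow]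
  simp only [Real.rpow_ofNat]
  rw [Real.sq_sqrt h]
  simp

lemma frobenius_norm_sq_eq_trace (M : Matrix ι ι ℝ) : ‖M‖ ^ 2 = (Mᵀ * M).trace := by
  rw [frobenius_norm_sq, Finset.sum_comm]
  simp [Matrix.trace, Matrix.mul_apply, sq]

/-- This is the reason for working with the Frobenius norm: entrywise multipliers with values in
`[0, 1]` are contractions, and the norm is still orthogonally invariant. -/
lemma frobenius_norm_mono {M M' : Matrix ι ι ℝ} (h : ∀ i j, |M i j| ≤ |M' i j|) :
    ‖M‖ ≤ ‖M'‖ := by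
  refine le_of_sq_le_sq ?_ (norm_nonneg _)
  rw [frobenius_norm_sq, frobenius_norm_sq]
  exact Finset.sum_le_sum fun i _ => Finset.sum_le_sum fun j _ => sq_le_sq.2 (h i j)

lemma frobenius_norm_orthogonal_mul {U : Matrix ι ι ℝ} (hU : Uᵀ * U = 1) (M : Matrix ι ι ℝ) :
    ‖U * M‖ = ‖M‖ := by
  refine (sq_eq_sq₀ (norm_nonneg _) (norm_nonneg _)).1 ?_
  rw [frobenius_norm_sq_eq_trace, frobenius_norm_sq_eq_trace, transpose_mul, Matrix.mul_assoc,
    ← Matrix.mul_assoc Uᵀ, hU, Matrix.one_mul]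

lemma frobenius_norm_mul_orthogonal {U : Matrix ι ι ℝ} (hU : Uᵀ * U = 1) (M : Matrix ι ι ℝ) :
    ‖M * U‖ = ‖M‖ := by
  have hU' : Uᵀᵀ * Uᵀ = 1 := by rw [transpose_transpose]; exact mul_eq_one_comm.1 hU
  rw [← frobenius_norm_transpose, transpose_mul, frobenius_norm_orthogonal_mul hU',
    frobenius_norm_transpose]

/-- Orthogonal projections do not increase the Frobenius norm. -/
lemma frobenius_norm_proj_mul_le {P : Matrix ι ι ℝ} (hs : Pᵀ = P) (hP : P * P = P)
    (M : Matrix ι ι ℝ) : ‖P * M‖ ≤ ‖M‖ := by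
  refine le_of_sq_le_sq ?_ (norm_nonneg _)
  have h : ‖M‖ ^ 2 = ‖P * M‖ ^ 2 + ‖(1 - P) * M‖ ^ 2 := by
    simp only [frobenius_norm_sq_eq_trace, transpose_mul, transpose_sub, hs, transpose_one]
    rw [← trace_add]
    congr 1
    have : (1 - P) * (1 - P) = 1 - P := by simp [sub_mul, mul_sub, hP]
    rw [Matrix.mul_assoc, ← Matrix.mul_assoc P, hP, Matrix.mul_assoc Mᵀ (1 - P),
      ← Matrix.mul_assoc (1 - P), this]
    noncomm_ring
  nlinarith [sq_nonneg ‖(1 - P) * M‖]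

lemma frobenius_norm_mul_proj_le {P : Matrix ι ι ℝ} (hs : Pᵀ = P) (hP : P * P = P)
    (M : Matrix ι ι ℝ) : ‖M * P‖ ≤ ‖M‖ := by
  rw [← frobenius_norm_transpose, transpose_mul, hs, ← frobenius_norm_transpose M]
  exact frobenius_norm_proj_mul_le hs hP _

/-- Two orthogonal projections of equal trace are close if the range of one is almost
contained in that of the other. -/
lemma frobenius_norm_proj_sub_sq {P Q : Matrix ι ι ℝ} (hPs : Pᵀ = P) (hP : P * P = P)
    (hQs : Qᵀ = Q) (hQ : Q * Q = Q) (htr : P.trace = Q.trace) :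
    ‖P - Q‖ ^ 2 = 2 * ‖(1 - P) * Q‖ ^ 2 := by
  have h1 : (P - Q)ᵀ * (P - Q) = P - P * Q - Q * P + Q := by
    rw [transpose_sub, hPs, hQs]; simp only [sub_mul, mul_sub, hP, hQ]; abel
  have h2 : ((1 - P) * Q)ᵀ * ((1 - P) * Q) = Q - Q * P * Q := by
    have : (1 - P) * (1 - P) = 1 - P := by simp [sub_mul, mul_sub, hP]
    rw [transpose_mul, transpose_sub, hPs, hQs, transpose_one, Matrix.mul_assoc,
      ← Matrix.mul_assoc (1 - P), this]
    simp only [sub_mul, mul_sub, hQ, Matrix.one_mul, ← Matrix.mul_assoc]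
  have h3 : (Q * P * Q).trace = (P * Q).trace := by
    rw [trace_mul_comm, ← Matrix.mul_assoc, hQ, trace_mul_comm]
  have h4 : (Q * P).trace = (P * Q).trace := trace_mul_comm _ _
  rw [frobenius_norm_sq_eq_trace, frobenius_norm_sq_eq_trace, h1, h2]
  simp only [trace_sub, trace_add, h3, h4, htr]
  ring

/-- The coordinate projection onto the coordinates satisfying `p`. -/
def coordProj (p : ι → Prop) [DecidablePred p] : Matrix ι ι ℝ :=
  diagonal fun i => if p i then 1 else 0

lemma coordProj_transpose {ι : Type*} [DecidableEq ι] (p : ι → Prop) [DecidablePred p] :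
    (coordProj p)ᵀ = coordProj p := diagonal_transpose _

variable (p : ι → Prop) [DecidablePred p]

lemma coordProj_mul_self : coordProj p * coordProj p = coordProj p := by
  simp [coordProj]

lemma coordProj_mul_diagonal (s : ι → ℝ) :
    coordProj p * diagonal s = diagonal s * coordProj p := by
  simp [coordProj, mul_comm]

end Frobenius

/-! ### The Riccati equation for an invariant graph -/

section Riccati

open scoped Matrix.Norms.Frobenius

variable {ι : Type*} [Fintype ι] [DecidableEq ι]

/-- The solution `X` of the Sylvester equation `X * D + D * X = W * D` with `D = diagonal s`. -/
def sylvesterSol (s : ι → ℝ) (W : Matrix ι ι ℝ) : Matrix ι ι ℝ :=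
  of fun i j => s j / (s i + s j) * W i j

/-- In other words, `D * X * D⁻¹ = W - X`. With `W` as the unknown, conjugation by `D` is thus
controlled without any ratio of entries of `D`. -/
lemma diagonal_mul_sylvesterSol {s : ι → ℝ} (hs : ∀ i, 0 < s i) (W : Matrix ι ι ℝ) :
    diagonal s * sylvesterSol s W = (W - sylvesterSol s W) * diagonal s := by
  ext i j
  have := hs i
  have := hs j
  simp only [diagonal_mul, mul_diagonal, sylvesterSol, of_apply, Matrix.sub_apply]
  field_simp
  ring

lemma sylvesterSol_sub {ι : Type*} (s : ι → ℝ) (W W' : Matrix ι ι ℝ) :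
    sylvesterSol s W - sylvesterSol s W' = sylvesterSol s (W - W') := by
  ext i j
  simp [sylvesterSol, mul_sub]

/-- The multiplier `s j / (s i + s j)` lies in `[0, 1]` for all positive `s`; a difference in the
denominator would require a gap. -/
lemma norm_sylvesterSol_le {s : ι → ℝ} (hs : ∀ i, 0 < s i) (W : Matrix ι ι ℝ) :
    ‖sylvesterSol s W‖ ≤ ‖W‖ := by
  refine frobenius_norm_mono fun i j => ?_
  have hi := hs i
  have hj := hs j
  have h : |s j / (s i + s j)| ≤ 1 := by
    rw [abs_of_nonneg (by positivity), div_le_one (by positivity)]; linarith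
  simpa [sylvesterSol, abs_mul] using mul_le_mul_of_nonneg_right h (abs_nonneg (W i j))

lemma norm_sub_sylvesterSol_le {s : ι → ℝ} (hs : ∀ i, 0 < s i) (W : Matrix ι ι ℝ) :
    ‖W - sylvesterSol s W‖ ≤ ‖W‖ := by
  refine frobenius_norm_mono fun i j => ?_
  have hi := hs i
  have hj := hs j
  have h : |s i / (s i + s j)| ≤ 1 := by
    rw [abs_of_nonneg (by positivity), div_le_one (by positivity)]; linarith
  have e : W i j - s j / (s i + s j) * W i j = s i / (s i + s j) * W i j := by
    field_simp; ring
  simpa [sylvesterSol, e, abs_mul] using mul_le_mul_of_nonneg_right h (abs_nonneg (W i j))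

variable {p : ι → Prop} [DecidablePred p]

lemma sylvesterSol_corner (s : ι → ℝ) (W : Matrix ι ι ℝ) :
    sylvesterSol s ((1 - coordProj p) * W * coordProj p) =
      (1 - coordProj p) * sylvesterSol s W * coordProj p := by
  have h : (1 - coordProj p) = diagonal fun i => if p i then (0 : ℝ) else 1 := by
    rw [coordProj, ← diagonal_one, diagonal_sub]
    congr 1; ext i; split_ifs <;> simp
  rw [h]
  ext i j
  simp [sylvesterSol, coordProj]

/-- Block form of the conjugate of `U * (D + N)` by the shear `1 + X`. -/
lemma shear_conj_blocks {R : Type*} [Ring R] {e U E X T F N D Di C : R} (he : e * e = e)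
    (hU : U = e - (1 - e) + E) (hXl : e * X = 0) (hXr : X * e = X)
    (hNl : e * N = N) (hNr : N * e = 0) (hD : D * Di = 1) (heD : e * D = D * e)
    (hDe : e * Di = Di * e) (hT : T = D * X * Di) (hF : F = N * X * Di)
    (hC : C = (1 - X) * (U * (D + N)) * (1 + X)) :
    (1 - e) * C * e * Di = (1 - e - X) * E * (e + T + F) - X * F - X - T ∧
    e * C * e * Di = e + F + e * E * (e + T + F) ∧
    (1 - e) * C * (1 - e) * Di =
      - (1 - e) - X * (N * Di) + (1 - e - X) * E * (1 - e + N * Di) := by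
  have hDDi (Y : R) : D * (Di * Y) = Y := by rw [← mul_assoc, hD, one_mul]
  have h2 (Y : R) : e * (X * Y) = 0 := by rw [← mul_assoc, hXl, zero_mul]
  have h3 (Y : R) : X * (e * Y) = X * Y := by rw [← mul_assoc, hXr]
  have h4 (Y : R) : e * (N * Y) = N * Y := by rw [← mul_assoc, hNl]
  have h6 (Y : R) : X * (D * (X * Y)) = 0 := by
    rw [← h3, ← mul_assoc e, heD, mul_assoc, h2, mul_zero, mul_zero]
  have h8 (Y : R) : e * (D * Y) = D * (e * Y) := by rw [← mul_assoc, heD, mul_assoc]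
  subst hU hT hF hC
  refine ⟨?_, ?_, ?_⟩ <;>
  · simp only [mul_add, add_mul, mul_sub, sub_mul, mul_assoc, one_mul, mul_one, neg_mul, mul_neg,
      he, hXl, hXr, hNl, hNr, hD, hDe, heD, hDDi, h2, h4, h6, h8,
      mul_zero, zero_mul, sub_zero, zero_sub, add_zero]
    abel

/-- Banach's theorem on the closed ball of radius `R`, which is mapped to itself because `R / 2 + R
/ 2 = R`. -/
lemma exists_fixedPoint_of_half_lipschitz {V : Type*} [NormedAddCommGroup V] [CompleteSpace V]
    {f : V → V} {R : ℝ} (h0 : ‖f 0‖ ≤ R / 2)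
    (hf : ∀ x y, ‖x‖ ≤ R → ‖y‖ ≤ R → ‖f x - f y‖ ≤ 1 / 2 * ‖x - y‖) :
    ∃ x, ‖x‖ ≤ R ∧ f x = x := by
  have hR : 0 ≤ R := by linarith [norm_nonneg (f 0)]
  have hmaps : Set.MapsTo f (Metric.closedBall 0 R) (Metric.closedBall 0 R) := by
    intro x hx
    rw [mem_closedBall_zero_iff] at hx ⊢
    have h1 := hf x 0 hx (by simpa using hR)
    have h2 : ‖f x‖ ≤ ‖f x - f 0‖ + ‖f 0‖ := by simpa using norm_add_le (f x - f 0) (f 0)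
    rw [sub_zero] at h1
    linarith
  have hc : ContractingWith (1 / 2) (hmaps.restrict f _ _) := by
    refine ⟨by
      rw [← NNReal.coe_lt_coe]
      norm_num, LipschitzWith.of_dist_le_mul fun x y => ?_⟩
    have := hf x y (mem_closedBall_zero_iff.1 x.2) (mem_closedBall_zero_iff.1 y.2)
    simpa [Subtype.dist_eq, dist_eq_norm] using this
  obtain ⟨x, hx, hfix, -⟩ := ContractingWith.exists_fixedPoint' Metric.isClosed_closedBall.isComplete
    hmaps hc (Metric.mem_closedBall_self hR) (edist_ne_top _ _)
  exact ⟨x, mem_closedBall_zero_iff.1 hx, hfix⟩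

/-- Lipschitz estimate for the polynomial map of the Riccati equation. -/
lemma norm_riccati_sub_le {R : Type*} [NormedRing R] {a b c E x t f x' t' f' : R}
    {ε ρ K r d : ℝ} (hr : 0 ≤ r) (ha : ‖a‖ ≤ ε) (hb : ‖b‖ ≤ ρ) (hc : ‖c‖ ≤ ε)
    (hE : ‖E‖ ≤ ε) (hx' : ‖x'‖ ≤ r) (ht : ‖t‖ ≤ r) (hf : ‖f‖ ≤ K * r)
    (hdx : ‖x - x'‖ ≤ d) (hdt : ‖t - t'‖ ≤ d) (hdf : ‖f - f'‖ ≤ K * d) :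
    ‖(b + a * t + b * f - x * c - x * E * t - x * E * f - x * f) -
      (b + a * t' + b * f' - x' * c - x' * E * t' - x' * E * f' - x' * f')‖ ≤
      (2 * ε + ρ * K + 2 * ε * r + 2 * ε * K * r + 2 * K * r) * d := by
  have hε : 0 ≤ ε := (norm_nonneg _).trans ha
  have hρ : 0 ≤ ρ := (norm_nonneg _).trans hb
  have hd : 0 ≤ d := (norm_nonneg _).trans hdx
  have key : (b + a * t + b * f - x * c - x * E * t - x * E * f - x * f) -
      (b + a * t' + b * f' - x' * c - x' * E * t' - x' * E * f' - x' * f') =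
      a * (t - t') + b * (f - f') - (x - x') * c - (x - x') * E * t - x' * E * (t - t')
        - (x - x') * E * f - x' * E * (f - f') - (x - x') * f - x' * (f - f') := by
    noncomm_ring
  have m2 {u v : R} {α β : ℝ} (hα : 0 ≤ α) (hu : ‖u‖ ≤ α) (hv : ‖v‖ ≤ β) : ‖u * v‖ ≤ α * β :=
    (norm_mul_le _ _).trans (mul_le_mul hu hv (norm_nonneg _) hα)
  have m3 {u v w : R} {α β γ : ℝ} (hα : 0 ≤ α) (hβ : 0 ≤ β) (hu : ‖u‖ ≤ α) (hv : ‖v‖ ≤ β)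
      (hw : ‖w‖ ≤ γ) : ‖u * v * w‖ ≤ α * β * γ := m2 (by positivity) (m2 hα hu hv) hw
  rw [key]
  calc _ ≤ ε * d + ρ * (K * d) + d * ε + d * ε * r + r * ε * d + d * ε * (K * r)
        + r * ε * (K * d) + d * (K * r) + r * (K * d) := by
        refine (norm_sub_le _ _).trans (add_le_add ?_ (m2 hr hx' hdf))
        refine (norm_sub_le _ _).trans (add_le_add ?_ (m2 hd hdx hf))
        refine (norm_sub_le _ _).trans (add_le_add ?_ (m3 hr hε hx' hE hdf))
        refine (norm_sub_le _ _).trans (add_le_add ?_ (m3 hd hε hdx hE hf))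
        refine (norm_sub_le _ _).trans (add_le_add ?_ (m3 hr hε hx' hE hdt))
        refine (norm_sub_le _ _).trans (add_le_add ?_ (m3 hd hε hdx hE ht))
        refine (norm_sub_le _ _).trans (add_le_add ?_ (m2 hd hdx hc))
        exact (norm_add_le _ _).trans (add_le_add (m2 hε ha hdt) (m2 hρ hb hdf))
    _ = _ := by ring

lemma norm_corner_le (W : Matrix ι ι ℝ) :
    ‖(1 - coordProj p) * W * coordProj p‖ ≤ ‖W‖ := by
  have hs := coordProj_transpose p
  have he := coordProj_mul_self p
  refine (frobenius_norm_mul_proj_le hs he _).trans (frobenius_norm_proj_mul_le ?_ ?_ _)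
  · rw [transpose_sub, hs, transpose_one]
  · simp [sub_mul, mul_sub, he]

/-- If `U` is close to the reflection in the coordinate subspace and almost preserves that
subspace, then `U * (D + N)`, with `D + N` block upper triangular, has an invariant subspace
close to the coordinate subspace, together with control on the induced diagonal blocks. -/
lemma exists_shear_blockTriangular {s : ι → ℝ} (hs : ∀ i, 0 < s i) {N : Matrix ι ι ℝ}
    (hNl : coordProj p * N = N) (hNr : N * coordProj p = 0) :
    ∃ r₀ > 0, ∀ r, 0 < r → r ≤ r₀ → ∀ U : Matrix ι ι ℝ, Uᵀ * U = 1 →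
      ‖U - (coordProj p - (1 - coordProj p))‖ ≤ 1 / 16 →
      ‖U * coordProj p * Uᵀ - coordProj p‖ ≤ r / 16 →
      ∃ X C : Matrix ι ι ℝ, coordProj p * X = 0 ∧ X * coordProj p = X ∧ ‖X‖ ≤ r / 8 ∧
        C = (1 - X) * (U * (diagonal s + N)) * (1 + X) ∧
        (1 - coordProj p) * C * coordProj p = 0 ∧
        ‖coordProj p * C * coordProj p * diagonal s⁻¹ - coordProj p‖ ≤ 1 / 4 ∧
        ‖(1 - coordProj p) * C * (1 - coordProj p) * diagonal s⁻¹ + (1 - coordProj p)‖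
          ≤ 1 / 4 := by
  set e := coordProj p with he_def
  set D := diagonal s with hD_def
  set Di := diagonal s⁻¹ with hDi_def
  have hes : eᵀ = e := coordProj_transpose p
  have he : e * e = e := coordProj_mul_self p
  have hqs : (1 - e)ᵀ = 1 - e := by rw [transpose_sub, hes, transpose_one]
  have hq : (1 - e) * (1 - e) = 1 - e := by simp [sub_mul, mul_sub, he]
  have hD : D * Di = 1 := by
    rw [hD_def, hDi_def, diagonal_mul_diagonal, ← diagonal_one]
    congr 1; ext i; simp [(hs i).ne']
  have heD : e * D = D * e := coordProj_mul_diagonal p s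
  have heDi : e * Di = Di * e := coordProj_mul_diagonal p s⁻¹
  have hDi : Di * D = 1 := mul_eq_one_comm.1 hD
  set K := ‖N‖ * ‖Di‖ with hK_def
  have hK : 0 ≤ K := by positivity
  -- The threshold depends on the matrix through `K`. This is harmless: the covering argument only
  -- needs arbitrarily small radii to be allowed at each plane.
  refine ⟨1 / (16 * (1 + K)), by positivity, fun r hr hr0 U hU hUJ hUe => ?_⟩
  have hrK : r * (1 + K) ≤ 1 / 16 := by
    rw [le_div_iff₀ (by positivity)] at hr0
    linarith
  have hr1 : r ≤ 1 / 16 := by nlinarith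
  have hr2 : K * r ≤ 1 / 16 := by nlinarith
  have hKr : 0 ≤ K * r := by positivity
  set E := U - (e - (1 - e)) with hE_def
  have hUE : U = e - (1 - e) + E := by rw [hE_def]; abel
  have hqe : (1 - e) * e = 0 := by rw [sub_mul, he, one_mul, sub_self]
  have ha : ‖(1 - e) * E‖ ≤ 1 / 16 := (frobenius_norm_proj_mul_le hqs hq _).trans hUJ
  have hc : ‖E * e‖ ≤ 1 / 16 := (frobenius_norm_mul_proj_le hes he _).trans hUJ
  -- The inhomogeneous term of the Riccati equation is the one corner of `E` that must be of order
  -- `r`: it measures how far `U` moves the coordinate subspace.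
  have hb : ‖(1 - e) * E * e‖ ≤ r / 16 := by
    have h1 : (1 - e) * E * e = (1 - e) * (U * e * Uᵀ - e) * U * e := by
      have : (1 - e) * (U * e * Uᵀ - e) * U * e = (1 - e) * U * e * (Uᵀ * U) * e
          - ((1 - e) * e) * U * e := by noncomm_ring
      rw [this, hU, hqe, hE_def, mul_one, mul_assoc _ e e, he]
      have : (1 - e) * (U - (e - (1 - e))) * e =
        (1 - e) * U * e - ((1 - e) * e) * e + ((1 - e) * (1 - e)) * e := by noncomm_ring
      rw [this, hqe, hq, hqe]; simp
    rw [h1]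
    refine (frobenius_norm_mul_proj_le hes he _).trans ?_
    rw [frobenius_norm_mul_orthogonal hU]
    exact (frobenius_norm_proj_mul_le hqs hq _).trans hUe
  set x : Matrix ι ι ℝ → Matrix ι ι ℝ := fun W => sylvesterSol s ((1 - e) * W * e) with hx_def
  set t : Matrix ι ι ℝ → Matrix ι ι ℝ := fun W => (1 - e) * W * e - x W with ht_def
  set f : Matrix ι ι ℝ → Matrix ι ι ℝ := fun W => N * x W * Di with hf_def
  have hx (W) : ‖x W‖ ≤ ‖W‖ := (norm_sylvesterSol_le hs _).trans (norm_corner_le W)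
  have ht (W) : ‖t W‖ ≤ ‖W‖ := (norm_sub_sylvesterSol_le hs _).trans (norm_corner_le W)
  have hf (W) : ‖f W‖ ≤ K * ‖W‖ := by
    calc ‖N * x W * Di‖ ≤ ‖N‖ * ‖x W‖ * ‖Di‖ :=
          (norm_mul_le _ _).trans (mul_le_mul_of_nonneg_right (norm_mul_le _ _) (norm_nonneg _))
      _ ≤ ‖N‖ * ‖W‖ * ‖Di‖ := by gcongr; exact hx W
      _ = K * ‖W‖ := by rw [hK_def]; ring
  have hdx (W W') : x W - x W' = x (W - W') := by
    simp only [hx_def, sylvesterSol_sub]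
    congr 1; noncomm_ring
  have hdt (W W') : t W - t W' = t (W - W') := by
    simp only [ht_def, ← hdx, mul_sub, sub_mul]; abel
  have hdf (W W') : f W - f W' = f (W - W') := by
    simp only [hf_def, ← hdx, mul_sub, sub_mul]
  have hx0 : x 0 = 0 := by simpa using hx 0
  have ht0 : t 0 = 0 := by simpa using ht 0
  have hf0 : f 0 = 0 := by simpa using hf 0
  -- By the first formula of `shear_conj_blocks`, the lower left corner vanishes when `X + T` equals
  -- this expression; for `X = x W` and `T = t W` that is `G W = W`.
  set G : Matrix ι ι ℝ → Matrix ι ι ℝ := fun W => (1 - e) * E * e + (1 - e) * E * t W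
    + (1 - e) * E * e * f W - x W * (E * e) - x W * E * t W - x W * E * f W - x W * f W with hG_def
  obtain ⟨W, hW, hfix⟩ := exists_fixedPoint_of_half_lipschitz (f := G) (R := r / 8)
    (by simp only [hG_def, hx0, ht0, hf0, mul_zero, zero_mul, add_zero, sub_zero]; linarith)
    (by
      intro W W' hW hW'
      refine (norm_riccati_sub_le (ε := 1 / 16) (ρ := r / 16) (K := K) (r := r / 8)
        (d := ‖W - W'‖) (by positivity) ha hb hc hUJ ((hx _).trans hW')
        ((ht _).trans hW) ((hf _).trans (by gcongr)) (hdx W W' ▸ hx _) (hdt W W' ▸ ht _)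
        (hdf W W' ▸ hf _)).trans ?_
      gcongr
      nlinarith)
  have hXcorner : x W = (1 - e) * sylvesterSol s W * e := sylvesterSol_corner s W
  have heq : e * (1 - e) = 0 := by rw [mul_sub, he, mul_one, sub_self]
  have hXl : e * x W = 0 := by rw [hXcorner, ← mul_assoc, ← mul_assoc, heq, zero_mul, zero_mul]
  have hXr : x W * e = x W := by rw [hXcorner, mul_assoc, he]
  have hT : t W = D * x W * Di := by
    rw [hx_def, hD_def, diagonal_mul_sylvesterSol hs, mul_assoc, hD, mul_one]
  obtain ⟨h21, h11, h22⟩ := shear_conj_blocks (F := f W) (C := (1 - x W) * (U * (D + N)) * (1 + x W))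
    he hUE hXl hXr hNl hNr hD heD heDi hT rfl rfl
  have hef : e * f W = f W := by simp only [hf_def, ← mul_assoc, hNl]
  have hfe : f W * e = f W := by
    simp only [hf_def]; rw [mul_assoc, ← heDi, ← mul_assoc, mul_assoc N, hXr]
  have hte : t W * e = t W := by
    simp only [ht_def]; rw [sub_mul, hXr, mul_assoc _ e e, he]
  have hqx : (1 - e) * x W = x W := by rw [sub_mul, hXl, one_mul, sub_zero]
  have hGW : G W = (1 - e - x W) * E * (e + t W + f W) - x W * f W := by
    simp only [hG_def]
    have : (1 - e) * E * e * f W = (1 - e) * E * f W := by rw [mul_assoc _ e, hef]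
    rw [this]
    noncomm_ring
  -- `G` takes values in the lower left corner, so its fixed point lies there, and `x W + t W` is
  -- `W` itself.
  have hWc : (1 - e) * W * e = W := by
    rw [← hfix, hGW]
    have h1 : (1 - e) * (1 - e - x W) = 1 - e - x W := by rw [mul_sub, hq, hqx]
    have h2 : (e + t W + f W) * e = e + t W + f W := by rw [add_mul, add_mul, he, hte, hfe]
    calc _ = (1 - e) * (1 - e - x W) * E * ((e + t W + f W) * e)
          - (1 - e) * x W * (f W * e) := by noncomm_ring
      _ = _ := by rw [h1, h2, hqx, hfe]
  have hxt : x W + t W = W := by simp only [ht_def]; rw [hWc]; abel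
  have hxr := (hx W).trans hW
  have htr := (ht W).trans hW
  have hfr : ‖f W‖ ≤ K * (r / 8) := (hf W).trans (by gcongr)
  have m2 {u v : Matrix ι ι ℝ} {α β : ℝ} (hα : 0 ≤ α) (hu : ‖u‖ ≤ α) (hv : ‖v‖ ≤ β) :
      ‖u * v‖ ≤ α * β := (norm_mul_le _ _).trans (mul_le_mul hu hv (norm_nonneg _) hα)
  refine ⟨x W, _, hXl, hXr, hxr, rfl, ?_, ?_, ?_⟩
  · have h0 : (1 - e) * ((1 - x W) * (U * (D + N)) * (1 + x W)) * e * Di = 0 := by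
      rw [h21, ← hGW, hfix, sub_sub, hxt, sub_self]
    calc _ = (1 - e) * ((1 - x W) * (U * (D + N)) * (1 + x W)) * e * Di * D := by
          rw [mul_assoc _ Di D, hDi, mul_one]
      _ = 0 := by rw [h0, zero_mul]
  · rw [h11]
    have : e + f W + e * E * (e + t W + f W) - e =
        f W + e * (E * e) + e * E * t W + e * E * f W := by noncomm_ring
    rw [this]
    have heE : ‖e * E‖ ≤ 1 / 16 := (frobenius_norm_proj_mul_le hes he _).trans hUJ
    have i1 := (frobenius_norm_proj_mul_le hes he (E * e)).trans hc
    have i2 := m2 (by norm_num) heE htr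
    have i3 := m2 (by norm_num) heE hfr
    refine (norm_add_le _ _).trans ((add_le_add ((norm_add_le _ _).trans
      (add_le_add ((norm_add_le _ _).trans (add_le_add hfr i1)) i2)) i3).trans ?_)
    nlinarith
  · rw [h22]
    have heN : e * (N * Di) = N * Di := by rw [← mul_assoc, hNl]
    have : - (1 - e) - x W * (N * Di) + (1 - e - x W) * E * (1 - e + N * Di) + (1 - e) =
        - (x W * (N * Di)) + (1 - e) * E * (1 - e) + (1 - e) * E * e * (N * Di)
        - x W * (E * (1 - e)) - x W * E * (N * Di) := by
      rw [mul_assoc _ e (N * Di), heN]; noncomm_ring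
    rw [this]
    have hND : ‖N * Di‖ ≤ K := norm_mul_le _ _
    have hr8 : 0 ≤ r / 8 := by positivity
    have hEq : ‖E * (1 - e)‖ ≤ 1 / 16 := (frobenius_norm_mul_proj_le hqs hq _).trans hUJ
    have i1 : ‖-(x W * (N * Di))‖ ≤ r / 8 * K := by rw [norm_neg]; exact m2 hr8 hxr hND
    have i2 := (frobenius_norm_mul_proj_le hqs hq ((1 - e) * E)).trans ha
    have i3 := m2 (by positivity) hb hND
    have i4 := m2 hr8 hxr hEq
    have i5 := m2 (by positivity) (m2 hr8 hxr hUJ) hND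
    refine (norm_sub_le _ _).trans ((add_le_add ((norm_sub_le _ _).trans (add_le_add
      ((norm_add_le _ _).trans (add_le_add ((norm_add_le _ _).trans (add_le_add i1 i2)) i3)) i4))
      i5).trans ?_)
    nlinarith

end Riccati

/-! ### Block Cholesky and block QR decompositions -/

section BlockQR

open scoped Matrix.Norms.Frobenius

lemma PosDef.exists_orthogonal_diagonalization {m : Type*} [Fintype m] [DecidableEq m]
    {H : Matrix m m ℝ} (hH : H.PosDef) :
    ∃ (K : Matrix m m ℝ) (s : m → ℝ), Kᵀ * K = 1 ∧ (∀ i, 0 < s i) ∧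
      Kᵀ * H * K = diagonal s * diagonal s := by
  have hu := (Unitary.mem_iff.1 hH.isHermitian.eigenvectorUnitary.2).1
  refine ⟨hH.isHermitian.eigenvectorUnitary, fun i => √(hH.isHermitian.eigenvalues i), ?_,
    fun i => Real.sqrt_pos.2 (hH.eigenvalues_pos i), ?_⟩
  · simpa [star_eq_conjTranspose] using hu
  · have h := hH.isHermitian.conjStarAlgAut_star_eigenvectorUnitary
    rw [Unitary.conjStarAlgAut_apply] at h
    simp only [Unitary.coe_star, star_eq_conjTranspose, conjTranspose_eq_transpose_of_trivial,
      transpose_transpose] at h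
    rw [h, diagonal_mul_diagonal]
    congr 1
    ext i
    simp [Real.mul_self_sqrt (hH.eigenvalues_pos i).le]

/-- A block Cholesky decomposition with diagonal diagonal blocks. -/
lemma PosDef.exists_block_cholesky {m n : Type*} [Fintype m] [DecidableEq m] [Fintype n]
    [DecidableEq n] {H : Matrix (m ⊕ n) (m ⊕ n) ℝ} (hH : H.PosDef) :
    ∃ (K₁ : Matrix m m ℝ) (K₂ : Matrix n n ℝ) (s₁ : m → ℝ) (s₂ : n → ℝ) (N : Matrix m n ℝ),
      K₁ᵀ * K₁ = 1 ∧ K₂ᵀ * K₂ = 1 ∧ (∀ i, 0 < s₁ i) ∧ (∀ i, 0 < s₂ i) ∧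
      (fromBlocks K₁ 0 0 K₂)ᵀ * H * fromBlocks K₁ 0 0 K₂ =
        (fromBlocks (diagonal s₁) N 0 (diagonal s₂))ᵀ *
          fromBlocks (diagonal s₁) N 0 (diagonal s₂) := by
  set A := H.toBlocks₁₁ with hA
  set B := H.toBlocks₁₂ with hB
  set D := H.toBlocks₂₂ with hD
  have hsymm : Hᵀ = H := by simpa using hH.isHermitian.eq
  have hHb : H = fromBlocks A B Bᵀ D := by
    conv_lhs => rw [← fromBlocks_toBlocks H]
    congr 1
    ext i j
    exact congrFun (congrFun hsymm.symm (Sum.inr i)) (Sum.inl j)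
  have hApos : A.PosDef := hH.submatrix Sum.inl_injective
  have hAs : Aᵀ = A := by simpa using hApos.isHermitian.eq
  have hdet : IsUnit A.det := hApos.det_pos.ne'.isUnit
  -- Block elimination: the congruence by `L` exhibits the Schur complement as a diagonal block of a
  -- positive definite matrix. `K₁` and `K₂` then diagonalize `A` and the Schur complement.
  set L : Matrix (m ⊕ n) (m ⊕ n) ℝ := fromBlocks 1 (-(A⁻¹ * B)) 0 1 with hL
  have hLHL : Lᵀ * H * L = fromBlocks A 0 0 (D - Bᵀ * A⁻¹ * B) := by
    have hAi : (A⁻¹)ᵀ = A⁻¹ := by rw [transpose_nonsing_inv, hAs]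
    have h1 : A * (A⁻¹ * B) = B := by rw [← Matrix.mul_assoc, mul_nonsing_inv _ hdet, Matrix.one_mul]
    have h2 : Bᵀ * A⁻¹ * A = Bᵀ := by rw [Matrix.mul_assoc, nonsing_inv_mul _ hdet, Matrix.mul_one]
    rw [hHb, hL, fromBlocks_transpose, fromBlocks_multiply, fromBlocks_multiply]
    simp only [transpose_one, transpose_neg, transpose_mul, hAi, transpose_zero, Matrix.one_mul,
      Matrix.mul_one, Matrix.zero_mul, Matrix.mul_zero, add_zero, Matrix.mul_neg, Matrix.neg_mul,
      h1, h2, neg_add_cancel, zero_add, neg_zero]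
    congr 1
    rw [Matrix.mul_assoc, sub_eq_neg_add]
  have hLinj : Function.Injective L.mulVec := by
    rw [Matrix.mulVec_injective_iff_isUnit, Matrix.isUnit_iff_isUnit_det, hL,
      det_fromBlocks_zero₂₁]
    simp
  have hSpos : (D - Bᵀ * A⁻¹ * B).PosDef := by
    have h := (hH.conjTranspose_mul_mul_same hLinj).submatrix (Sum.inr_injective (α := m))
    rw [conjTranspose_eq_transpose_of_trivial, hLHL] at h
    exact h
  obtain ⟨K₁, s₁, hK₁, hs₁, hd₁⟩ := PosDef.exists_orthogonal_diagonalization hApos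
  obtain ⟨K₂, s₂, hK₂, hs₂, hd₂⟩ := PosDef.exists_orthogonal_diagonalization hSpos
  have hK₁' : K₁ * K₁ᵀ = 1 := mul_eq_one_comm.1 hK₁
  have hi : diagonal s₁ * diagonal s₁⁻¹ = 1 := by
    rw [diagonal_mul_diagonal, ← diagonal_one]
    congr 1; ext i; simp [(hs₁ i).ne']
  have hi' : diagonal s₁⁻¹ * diagonal s₁ = 1 := mul_eq_one_comm.1 hi
  have hAinv : A⁻¹ = K₁ * diagonal s₁⁻¹ * diagonal s₁⁻¹ * K₁ᵀ := by
    have hA' : A = K₁ * (diagonal s₁ * diagonal s₁) * K₁ᵀ := by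
      rw [← hd₁]
      calc A = (K₁ * K₁ᵀ) * A * (K₁ * K₁ᵀ) := by rw [hK₁']; simp
        _ = _ := by simp only [Matrix.mul_assoc]
    refine inv_eq_right_inv ?_
    calc A * (K₁ * diagonal s₁⁻¹ * diagonal s₁⁻¹ * K₁ᵀ)
        = K₁ * (diagonal s₁ * (diagonal s₁ * (K₁ᵀ * K₁) * diagonal s₁⁻¹) * diagonal s₁⁻¹)
          * K₁ᵀ := by rw [hA']; simp only [Matrix.mul_assoc]
      _ = 1 := by rw [hK₁, Matrix.mul_one, hi, Matrix.mul_one, hi, Matrix.mul_one, hK₁']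
  refine ⟨K₁, K₂, s₁, s₂, diagonal s₁⁻¹ * (K₁ᵀ * B * K₂), hK₁, hK₂, hs₁, hs₂, ?_⟩
  rw [hHb, fromBlocks_transpose, fromBlocks_transpose, fromBlocks_multiply, fromBlocks_multiply,
    fromBlocks_multiply]
  simp only [transpose_zero, Matrix.mul_zero, Matrix.zero_mul, add_zero, zero_add,
    diagonal_transpose, transpose_mul, transpose_transpose]
  congr 1
  · rw [← Matrix.mul_assoc (diagonal s₁), hi, Matrix.one_mul]
  · rw [Matrix.mul_assoc _ (diagonal s₁⁻¹), hi']; simp only [Matrix.mul_assoc, Matrix.mul_one]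
  · rw [← hd₂, hAinv]; simp only [Matrix.mul_assoc, Matrix.mul_sub, Matrix.sub_mul]; abel

variable {ι : Type*} [Fintype ι] [DecidableEq ι]

/-- An invertible matrix becomes block upper triangular with diagonal diagonal blocks after
multiplication by orthogonal matrices, the one on the right being block diagonal. -/
lemma exists_block_qr (p : ι → Prop) [DecidablePred p] {M : Matrix ι ι ℝ} (hM : IsUnit M.det) :
    ∃ (K W N : Matrix ι ι ℝ) (s : ι → ℝ), Kᵀ * K = 1 ∧ Wᵀ * W = 1 ∧ (∀ i, 0 < s i) ∧
      coordProj p * K = K * coordProj p ∧ coordProj p * N = N ∧ N * coordProj p = 0 ∧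
      M * K = W * (diagonal s + N) := by
  have hinj : Function.Injective M.mulVec :=
    Matrix.mulVec_injective_iff_isUnit.2 ((Matrix.isUnit_iff_isUnit_det M).2 hM)
  set σ := Equiv.sumCompl p
  have hpos : ((Mᵀ * M).submatrix σ σ).PosDef := by
    have := PosDef.conjTranspose_mul_self M hinj
    rw [conjTranspose_eq_transpose_of_trivial] at this
    exact this.submatrix σ.injective
  obtain ⟨K₁, K₂, s₁, s₂, N, hK₁, hK₂, hs₁, hs₂, h⟩ := PosDef.exists_block_cholesky hpos
  set φ : Matrix _ _ ℝ → Matrix ι ι ℝ := fun Y => Y.submatrix σ.symm σ.symm with hφ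
  have hmul (Y Z) : φ (Y * Z) = φ Y * φ Z := (submatrix_mul_equiv Y Z _ _ _).symm
  have hT (Y) : φ Yᵀ = (φ Y)ᵀ := rfl
  have hone : φ 1 = 1 := submatrix_one_equiv _
  have hback : φ ((Mᵀ * M).submatrix σ σ) = Mᵀ * M := by simp [hφ]
  have hadd (Y Z) : φ (Y + Z) = φ Y + φ Z := rfl
  have he : φ (fromBlocks 1 0 0 0) = coordProj p := by
    have h1 : fromBlocks 1 0 0 0 = (coordProj p).submatrix σ σ := by
      ext i j
      rcases i with ⟨i, hi⟩ | ⟨i, hi⟩ <;> rcases j with ⟨j, hj⟩ | ⟨j, hj⟩ <;>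
        simp [coordProj, diagonal_apply, one_apply, σ, hi]
      rintro rfl
      exact hj hi
    simp [hφ, h1]
  set s : ι → ℝ := Sum.elim s₁ s₂ ∘ σ.symm with hs
  have hspos (i) : 0 < s i := by
    simp only [hs, Function.comp]
    rcases σ.symm i with j | j
    exacts [hs₁ j, hs₂ j]
  have hdiag : diagonal s = φ (fromBlocks (diagonal s₁) 0 0 (diagonal s₂)) := by
    simp only [hφ, hs, fromBlocks_diagonal, submatrix_diagonal_equiv]
  set R := diagonal s + φ (fromBlocks 0 N 0 0) with hR
  have hR' : R = φ (fromBlocks (diagonal s₁) N 0 (diagonal s₂)) := by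
    rw [hR, hdiag, ← hadd, fromBlocks_add]; simp
  set K := φ (fromBlocks K₁ 0 0 K₂) with hK
  have hKR : Kᵀ * (Mᵀ * M) * K = Rᵀ * R := by
    rw [hR', hK, ← hT, ← hT, ← hmul, ← hback, ← hmul, ← hmul, h]
  have hKK : Kᵀ * K = 1 := by
    rw [hK, ← hT, ← hmul, fromBlocks_transpose, fromBlocks_multiply]
    simp [hK₁, hK₂, hone]
  have hRdet : IsUnit R.det := by
    rw [hR', hφ, det_submatrix_equiv_self, det_fromBlocks_zero₂₁, det_diagonal, det_diagonal]
    exact (mul_pos (Finset.prod_pos fun i _ => hs₁ i)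
      (Finset.prod_pos fun i _ => hs₂ i)).ne'.isUnit
  -- `M * K` and `R` have the same Gram matrix, so they differ by an orthogonal factor on the left.
  refine ⟨K, M * K * R⁻¹, φ (fromBlocks 0 N 0 0), s, hKK, ?_, hspos, ?_, ?_, ?_, ?_⟩
  · calc (M * K * R⁻¹)ᵀ * (M * K * R⁻¹) = (R⁻¹)ᵀ * (Kᵀ * (Mᵀ * M) * K) * R⁻¹ := by
          simp only [transpose_mul, Matrix.mul_assoc]
      _ = (R * R⁻¹)ᵀ * (R * R⁻¹) := by rw [hKR]; simp only [transpose_mul, Matrix.mul_assoc]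
      _ = 1 := by rw [mul_nonsing_inv _ hRdet]; simp
  · rw [← he, hK, ← hmul, ← hmul, fromBlocks_multiply, fromBlocks_multiply]; simp
  · rw [← he, ← hmul, fromBlocks_multiply]; simp
  · rw [← he, ← hmul, fromBlocks_multiply]; simp [hφ]
  · rw [← hR, Matrix.mul_assoc _ R⁻¹ R, nonsing_inv_mul _ hRdet, Matrix.mul_one]

end BlockQR

/-! ### Split invariant subspaces: uniqueness and existence -/

section Split

open scoped Matrix.Norms.Frobenius

variable {ι : Type*} [Fintype ι] [DecidableEq ι] {p : ι → Prop} [DecidablePred p]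

/-- The range of `P` is an invariant subspace of `B` such that, in suitable coordinates, `B` is
close to a positive diagonal matrix on the subspace, and to a negative one on the quotient. -/
def IsSplitInvariant (p : ι → Prop) [DecidablePred p] (B P : Matrix ι ι ℝ) : Prop :=
  ∃ (Z Zi Y C : Matrix ι ι ℝ) (s : ι → ℝ), (∀ i, 0 < s i) ∧ Z * Zi = 1 ∧ B * Z = Z * C ∧
    P = Z * coordProj p * Y ∧ P * Z * coordProj p = Z * coordProj p ∧
    (1 - coordProj p) * C * coordProj p = 0 ∧
    ‖coordProj p * C * coordProj p * diagonal s⁻¹ - coordProj p‖ ≤ 1 / 4 ∧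
    ‖(1 - coordProj p) * C * (1 - coordProj p) * diagonal s⁻¹ + (1 - coordProj p)‖ ≤ 1 / 4

lemma IsSplitInvariant.invariant {B P : Matrix ι ι ℝ} (h : IsSplitInvariant p B P) :
    (1 - P) * B * P = 0 := by
  obtain ⟨Z, Zi, Y, C, s, -, -, hBZ, hP, hPZ, hC, -⟩ := h
  set e := coordProj p
  have hC' : C * e = e * C * e := by
    rw [sub_mul, sub_mul, one_mul, sub_eq_zero] at hC; exact hC
  have h1 : B * P = Z * e * (C * e * Y) := by
    calc B * P = (B * Z) * e * Y := by rw [hP]; simp only [mul_assoc]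
      _ = Z * (C * e) * Y := by rw [hBZ]; simp only [mul_assoc]
      _ = _ := by conv_lhs => rw [hC']
                  simp only [mul_assoc]
  have h2 : P * (B * P) = B * P := by rw [h1, ← mul_assoc, ← mul_assoc P, hPZ]
  rw [mul_assoc, sub_mul, one_mul, h2, sub_self]

/-- If `Z` intertwines a matrix which is positive on the coordinate subspace with one which is
negative on the quotient, then it preserves the coordinate subspace. -/
lemma corner_eq_zero_of_intertwining {Z C C' : Matrix ι ι ℝ} {s s' : ι → ℝ} (hs : ∀ i, 0 < s i)
    (hs' : ∀ i, 0 < s' i) (hZ : Z * C = C' * Z) (hC : (1 - coordProj p) * C * coordProj p = 0)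
    (hC' : (1 - coordProj p) * C' * coordProj p = 0)
    (h1 : ‖coordProj p * C * coordProj p * diagonal s⁻¹ - coordProj p‖ ≤ 1 / 4)
    (h2 : ‖(1 - coordProj p) * C' * (1 - coordProj p) * diagonal s'⁻¹ + (1 - coordProj p)‖
      ≤ 1 / 4) :
    (1 - coordProj p) * Z * coordProj p = 0 := by
  set e := coordProj p
  have he : e * e = e := coordProj_mul_self p
  have hq : (1 - e) * (1 - e) = 1 - e := by simp [sub_mul, mul_sub, he]
  set Y := (1 - e) * Z * e with hY
  set T := diagonal s' * Y * diagonal s⁻¹ with hT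
  have hTij (i j) : T i j = s' i / s j * Y i j := by
    simp [hT, diagonal_mul, mul_diagonal]; ring
  have hYe : Y * e = Y := by rw [hY, mul_assoc, he]
  have hqY : (1 - e) * Y = Y := by rw [hY, ← mul_assoc, ← mul_assoc, hq]
  have hqd : (1 - e) * diagonal s' = diagonal s' * (1 - e) := by
    rw [sub_mul, coordProj_mul_diagonal, mul_sub, one_mul, mul_one]
  have hqT : (1 - e) * T = T := by
    rw [hT, ← mul_assoc, ← mul_assoc, hqd, mul_assoc _ (1 - e), hqY]
  have hinv : diagonal s'⁻¹ * diagonal s' = 1 := by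
    rw [diagonal_mul_diagonal, ← diagonal_one]
    congr 1; ext i; simp [(hs' i).ne']
  have hCe : C * e = e * C * e := by
    rw [sub_mul, sub_mul, one_mul, sub_eq_zero] at hC; exact hC
  have hqC : (1 - e) * C' = (1 - e) * C' * (1 - e) := by
    rw [mul_sub, hC', mul_one, sub_zero]
  have key : Y * (e * C * e * diagonal s⁻¹) =
      ((1 - e) * C' * (1 - e) * diagonal s'⁻¹) * T := by
    calc Y * (e * C * e * diagonal s⁻¹)
        = (Y * e) * (C * e) * diagonal s⁻¹ := by simp only [mul_assoc]
      _ = (1 - e) * Z * (e * C * e) * diagonal s⁻¹ := by rw [hYe, hY]; simp only [mul_assoc]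
      _ = (1 - e) * (Z * C) * e * diagonal s⁻¹ := by rw [← hCe]; simp only [mul_assoc]
      _ = (1 - e) * C' * (1 - e) * Z * e * diagonal s⁻¹ := by
          conv_lhs => rw [hZ, ← mul_assoc, hqC]
      _ = (1 - e) * C' * ((1 - e) * (1 - e)) * Z * e * diagonal s⁻¹ := by rw [hq]
      _ = (1 - e) * C' * (1 - e) * (diagonal s'⁻¹ * diagonal s') * Y * diagonal s⁻¹ := by
          rw [hinv, hY]; simp only [mul_assoc, one_mul]
      _ = _ := by rw [hT]; simp only [mul_assoc]
  -- If the blocks were exactly `D` and `-D'`, the intertwining relation would read `Y + T = 0`; the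
  -- right side collects the two errors.
  have hsum : Y + T = -(Y * (e * C * e * diagonal s⁻¹ - e)) +
      ((1 - e) * C' * (1 - e) * diagonal s'⁻¹ + (1 - e)) * T := by
    rw [mul_sub, add_mul, hqT, hYe, key]; abel
  -- Corresponding entries of `Y` and `T` have the same sign, since `T` is `Y` with positive
  -- weights, so nothing cancels in `Y + T`. Both errors together are then at most half of `‖Y +
  -- T‖`, which forces `Y = 0`.
  have hYn : ‖Y‖ ≤ ‖Y + T‖ := by
    refine frobenius_norm_mono fun i j => ?_
    have hr : 0 ≤ s' i / s j := div_nonneg (hs' i).le (hs j).le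
    rw [Matrix.add_apply, hTij, show Y i j + s' i / s j * Y i j = (1 + s' i / s j) * Y i j by ring,
      abs_mul, abs_of_nonneg (by positivity : 0 ≤ 1 + s' i / s j)]
    nlinarith [abs_nonneg (Y i j)]
  have hTn : ‖T‖ ≤ ‖Y + T‖ := by
    refine frobenius_norm_mono fun i j => ?_
    have hr : 0 ≤ s' i / s j := div_nonneg (hs' i).le (hs j).le
    rw [Matrix.add_apply, hTij, show Y i j + s' i / s j * Y i j = (1 + s' i / s j) * Y i j by ring,
      abs_mul, abs_mul, abs_of_nonneg hr, abs_of_nonneg (by positivity : 0 ≤ 1 + s' i / s j)]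
    nlinarith [abs_nonneg (Y i j)]
  have hbound : ‖Y + T‖ ≤ 1 / 2 * ‖Y + T‖ := by
    calc ‖Y + T‖ ≤ ‖Y * (e * C * e * diagonal s⁻¹ - e)‖ +
          ‖((1 - e) * C' * (1 - e) * diagonal s'⁻¹ + (1 - e)) * T‖ := by
          conv_lhs => rw [hsum]
          exact (norm_add_le _ _).trans (by rw [norm_neg])
      _ ≤ ‖Y + T‖ * (1 / 4) + 1 / 4 * ‖Y + T‖ := by
          refine add_le_add ((norm_mul_le _ _).trans ?_) ((norm_mul_le _ _).trans ?_)
          · exact mul_le_mul hYn h1 (norm_nonneg _) (norm_nonneg _)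
          · exact mul_le_mul h2 hTn (norm_nonneg _) (by norm_num)
      _ = _ := by ring
  have h0 : ‖Y‖ ≤ 0 := hYn.trans (by linarith)
  exact norm_le_zero_iff.1 h0

/-- The change of coordinates `Z'⁻¹ * Z` intertwines the two triangular forms of `B`. It therefore
preserves the coordinate subspace, which means that the range of `P` lies in that of `P'`. -/
lemma IsSplitInvariant.mul_eq {B P P' : Matrix ι ι ℝ} (h : IsSplitInvariant p B P)
    (h' : IsSplitInvariant p B P') : P' * P = P := by
  obtain ⟨Z, Zi, Y, C, s, hs, hZ, hBZ, hP, hPZ, hC, h1, h2⟩ := h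
  obtain ⟨Z', Zi', Y', C', s', hs', hZ', hBZ', hP', hPZ', hC', h1', h2'⟩ := h'
  have hZi' : Zi' * Z' = 1 := mul_eq_one_comm.1 hZ'
  have hint : (Zi' * Z) * C = C' * (Zi' * Z) := by
    calc (Zi' * Z) * C = Zi' * (B * Z) := by rw [hBZ, mul_assoc]
      _ = Zi' * (B * (Z' * Zi') * Z) := by rw [hZ', mul_one]
      _ = Zi' * (B * Z') * Zi' * Z := by simp only [mul_assoc]
      _ = (Zi' * Z') * C' * Zi' * Z := by rw [hBZ']; simp only [mul_assoc]
      _ = C' * (Zi' * Z) := by rw [hZi', one_mul, mul_assoc]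
  have h0 := corner_eq_zero_of_intertwining hs hs' hint hC hC' h1 h2'
  set e := coordProj p
  have h3 : Zi' * Z * e = e * (Zi' * Z) * e := by
    rw [sub_mul, sub_mul, one_mul, sub_eq_zero] at h0; exact h0
  have h4 : Z * e = Z' * e * (Zi' * Z * e) := by
    calc Z * e = (Z' * Zi') * Z * e := by rw [hZ', one_mul]
      _ = Z' * (Zi' * Z * e) := by simp only [mul_assoc]
      _ = Z' * (e * (Zi' * Z) * e) := by rw [← h3]
      _ = _ := by simp only [mul_assoc]
  have h5 : P' * (Z * e) = Z * e := by
    rw [h4, ← mul_assoc, ← mul_assoc P', hPZ']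
  rw [hP, ← mul_assoc, h5]

lemma IsSplitInvariant.unique {B P P' : Matrix ι ι ℝ} (h : IsSplitInvariant p B P)
    (h' : IsSplitInvariant p B P') (hs : Pᵀ = P) (hs' : P'ᵀ = P') : P = P' := by
  have h1 := congrArg transpose (h'.mul_eq h)
  rw [transpose_mul, hs, hs', h.mul_eq h'] at h1
  exact h1

/-- For every coordinate frame `V₀` there are a frame `V` of the same subspace and a frame `W` such
that `U * A` has a split invariant subspace close to that of `V₀` whenever `Vᵀ * U * W` is close to
the reflection in the coordinate subspace and almost preserves this subspace. -/
lemma exists_split_invariant_near (p : ι → Prop) [DecidablePred p] {A V₀ : Matrix ι ι ℝ}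
    (hA : IsUnit A.det) (hV₀ : V₀ᵀ * V₀ = 1) :
    ∃ V W : Matrix ι ι ℝ, Vᵀ * V = 1 ∧ Wᵀ * W = 1 ∧ ∃ r₀ > 0, ∀ r, 0 < r → r ≤ r₀ →
      ∀ U : Matrix ι ι ℝ, Uᵀ * U = 1 →
      ‖Vᵀ * U * W - (coordProj p - (1 - coordProj p))‖ ≤ 1 / 16 →
      ‖Vᵀ * U * W * coordProj p * (Vᵀ * U * W)ᵀ - coordProj p‖ ≤ r / 16 →
      ∃ V' : Matrix ι ι ℝ, V'ᵀ * V' = 1 ∧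
        ‖V' * coordProj p * V'ᵀ - V₀ * coordProj p * V₀ᵀ‖ ≤ r ∧
        IsSplitInvariant p (U * A) (V' * coordProj p * V'ᵀ) := by
  have hdet : IsUnit (A * V₀).det := by
    rw [det_mul]
    refine hA.mul ?_
    have := congrArg det hV₀
    rw [det_mul, det_transpose, det_one] at this
    exact IsUnit.of_mul_eq_one _ this
  -- As `K` commutes with the coordinate projection, the frame `V₀ * K` still represents the
  -- subspace of `V₀`.
  obtain ⟨K, W, N, s, hK, hW, hs, heK, hNl, hNr, hAK⟩ := exists_block_qr p hdet
  obtain ⟨r₀, hr₀, hex⟩ := exists_shear_blockTriangular hs hNl hNr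
  have hKK : K * Kᵀ = 1 := mul_eq_one_comm.1 hK
  have hV : (V₀ * K)ᵀ * (V₀ * K) = 1 := by
    rw [transpose_mul, mul_assoc, ← mul_assoc V₀ᵀ, hV₀, one_mul, hK]
  set V := V₀ * K with hVdef
  have hVV : V * Vᵀ = 1 := mul_eq_one_comm.1 hV
  refine ⟨V, W, hV, hW, r₀, hr₀, fun r hr hr' U hU hJ hP => ?_⟩
  have hU' : (Vᵀ * U * W)ᵀ * (Vᵀ * U * W) = 1 := by
    calc _ = Wᵀ * (Uᵀ * (V * Vᵀ) * U) * W := by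
          simp only [transpose_mul, transpose_transpose, mul_assoc]
      _ = 1 := by rw [hVV, mul_one, hU, mul_one, hW]
  obtain ⟨X, C, hXl, hXr, hXn, hC, hC21, hC11, hC22⟩ := hex r hr hr' _ hU' hJ hP
  set e := coordProj p with he_def
  have hes : eᵀ = e := coordProj_transpose p
  have he : e * e = e := coordProj_mul_self p
  have hXX : X * X = 0 := by
    calc X * X = X * e * X := by rw [hXr]
      _ = 0 := by rw [mul_assoc, hXl, mul_zero]
  have hX1 : (1 + X) * (1 - X) = 1 := by
    rw [mul_sub, mul_one, add_mul, one_mul, hXX]; abel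
  have hXdet : IsUnit (1 + X).det := by
    have := congrArg det hX1
    rw [det_mul, det_one] at this
    exact IsUnit.of_mul_eq_one _ this
  -- The shear `1 + X` is not orthogonal. Its block QR form gives an orthogonal `W₁` carrying the
  -- coordinate subspace to the same graph.
  obtain ⟨K₁, W₁, N₁, s₁, hK₁, hW₁, hs₁, heK₁, hNl₁, hNr₁, hXK⟩ := exists_block_qr p hXdet
  rw [← he_def] at heK₁ hNl₁ hNr₁
  have hKK₁ : K₁ * K₁ᵀ = 1 := mul_eq_one_comm.1 hK₁
  have heKT : K₁ᵀ * e = e * K₁ᵀ := by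
    have := congrArg transpose heK₁
    rwa [transpose_mul, transpose_mul, hes] at this
  have hXW : 1 + X = W₁ * (diagonal s₁ + N₁) * K₁ᵀ := by
    rw [← hXK, mul_assoc, hKK₁, mul_one]
  have hee : e * ((diagonal s₁ + N₁) * e) = (diagonal s₁ + N₁) * e := by
    rw [add_mul, hNr₁, add_zero, ← coordProj_mul_diagonal, ← mul_assoc, ← he_def, he]
  have hPX : W₁ * e * W₁ᵀ * ((1 + X) * e) = (1 + X) * e := by
    calc W₁ * e * W₁ᵀ * ((1 + X) * e)
        = W₁ * e * (W₁ᵀ * W₁) * ((diagonal s₁ + N₁) * (K₁ᵀ * e)) := by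
          rw [hXW]; simp only [mul_assoc]
      _ = W₁ * (e * ((diagonal s₁ + N₁) * e)) * K₁ᵀ := by
          rw [hW₁, heKT, mul_one]; simp only [mul_assoc]
      _ = W₁ * (diagonal s₁ + N₁) * (e * K₁ᵀ) := by rw [hee]; simp only [mul_assoc]
      _ = (1 + X) * e := by rw [← heKT, hXW]; simp only [mul_assoc]
  have hinv : diagonal s₁ * diagonal s₁⁻¹ = 1 := by
    rw [diagonal_mul_diagonal, ← diagonal_one]
    congr 1; ext i; simp [(hs₁ i).ne']
  have hWe : W₁ * e = (1 + X) * e * (K₁ * diagonal s₁⁻¹) := by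
    calc W₁ * e = W₁ * (diagonal s₁ * diagonal s₁⁻¹ + N₁ * e * diagonal s₁⁻¹) * e := by
          rw [hinv, hNr₁, zero_mul, add_zero, mul_one]
      _ = W₁ * (diagonal s₁ * diagonal s₁⁻¹ * e + N₁ * (e * diagonal s₁⁻¹) * e) := by
          simp only [mul_assoc, add_mul]
      _ = W₁ * (diagonal s₁ + N₁) * (diagonal s₁⁻¹ * e) := by
          rw [he_def, coordProj_mul_diagonal, ← he_def, ← mul_assoc N₁, mul_assoc _ e e, he]
          simp only [mul_assoc, add_mul]
      _ = (1 + X) * (K₁ * e) * diagonal s₁⁻¹ := by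
          rw [← hXK, ← coordProj_mul_diagonal]; simp only [mul_assoc, he_def]
      _ = _ := by rw [← heK₁]; simp only [mul_assoc]
  have hVe : V * e * Vᵀ = V₀ * e * V₀ᵀ := by
    calc V * e * Vᵀ = V₀ * (K * e) * Kᵀ * V₀ᵀ := by
          rw [hVdef]; simp only [transpose_mul, mul_assoc]
      _ = V₀ * e * (K * Kᵀ) * V₀ᵀ := by rw [← heK]; simp only [mul_assoc]
      _ = _ := by rw [hKK, mul_one]
  have hPs : (W₁ * e * W₁ᵀ)ᵀ = W₁ * e * W₁ᵀ := by
    simp only [transpose_mul, transpose_transpose, hes, mul_assoc]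
  have hPP : W₁ * e * W₁ᵀ * (W₁ * e * W₁ᵀ) = W₁ * e * W₁ᵀ := by
    calc _ = W₁ * e * (W₁ᵀ * W₁) * e * W₁ᵀ := by simp only [mul_assoc]
      _ = _ := by rw [hW₁, mul_one, mul_assoc W₁, he]
  have hform : V * W₁ * e * (V * W₁)ᵀ = V * (W₁ * e * W₁ᵀ) * Vᵀ := by
    simp only [transpose_mul, mul_assoc]
  refine ⟨V * W₁, ?_, ?_, V * (1 + X), (1 - X) * Vᵀ, K₁ * diagonal s₁⁻¹ * W₁ᵀ * Vᵀ, C, s, hs,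
    ?_, ?_, ?_, ?_, hC21, hC11, hC22⟩
  · rw [transpose_mul, mul_assoc, ← mul_assoc Vᵀ, hV, one_mul, hW₁]
  · have h1 : V * W₁ * e * (V * W₁)ᵀ - V₀ * e * V₀ᵀ = V * (W₁ * e * W₁ᵀ - e) * Vᵀ := by
      rw [hform, ← hVe, mul_sub, sub_mul]
    have hVt : Vᵀᵀ * Vᵀ = 1 := by rw [transpose_transpose, hVV]
    rw [h1, frobenius_norm_mul_orthogonal hVt, frobenius_norm_orthogonal_mul hV]
    have htr : (W₁ * e * W₁ᵀ).trace = e.trace := by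
      rw [trace_mul_comm, ← mul_assoc, hW₁, one_mul]
    have h2 := frobenius_norm_proj_sub_sq hPs hPP hes he htr
    have h3 : (1 - W₁ * e * W₁ᵀ) * e = -((1 - W₁ * e * W₁ᵀ) * X) := by
      have h4 : (1 - W₁ * e * W₁ᵀ) * ((1 + X) * e) = 0 := by
        rw [sub_mul, hPX, one_mul, sub_self]
      rw [add_mul, hXr, one_mul, mul_add] at h4
      exact eq_neg_of_add_eq_zero_left h4
    have h5 : ‖(1 - W₁ * e * W₁ᵀ) * e‖ ≤ r / 8 := by
      rw [h3, norm_neg]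
      refine (frobenius_norm_proj_mul_le ?_ ?_ X).trans hXn
      · rw [transpose_sub, hPs, transpose_one]
      · rw [mul_sub, sub_mul, sub_mul, hPP]; simp
    refine le_of_sq_le_sq ?_ hr.le
    rw [h2]
    nlinarith [norm_nonneg ((1 - W₁ * e * W₁ᵀ) * e)]
  · rw [mul_assoc, ← mul_assoc (1 + X), hX1, one_mul, hVV]
  · calc U * A * (V * (1 + X)) = U * (A * V₀ * K) * (1 + X) := by
          rw [hVdef]; simp only [mul_assoc]
      _ = (V * Vᵀ) * U * W * (diagonal s + N) * (1 + X) := by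
          rw [hAK, hVV]; simp only [mul_assoc, one_mul]
      _ = V * ((1 + X) * (1 - X)) * (Vᵀ * U * W * (diagonal s + N)) * (1 + X) := by
          rw [hX1]; simp only [mul_assoc, mul_one]
      _ = V * (1 + X) * C := by rw [hC]; simp only [mul_assoc]
  · rw [hform, hWe]; simp only [mul_assoc, he_def]
  · calc V * W₁ * e * (V * W₁)ᵀ * (V * (1 + X)) * e
        = V * (W₁ * e * W₁ᵀ) * (Vᵀ * V) * ((1 + X) * e) := by
          rw [hform]; simp only [mul_assoc]
      _ = V * (W₁ * e * W₁ᵀ * ((1 + X) * e)) := by rw [hV]; simp only [mul_assoc, one_mul]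
      _ = _ := by rw [hPX]; simp only [mul_assoc, he_def]

end Split

/-! ### Haar measure estimates and the Vitali covering argument -/

section Covering

open scoped Matrix.Norms.Frobenius

variable {n : ℕ}

instance instIsHaarMeasureHaarO : (haarO n).IsHaarMeasure := by
  unfold haarO; infer_instance

/-- Right translates are again Haar probability measures, hence equal to the original by uniqueness.
Two-sided invariance is needed because `V` and `W` multiply `U` on different sides. -/
instance instIsMulRightInvariantHaarO : (haarO n).IsMulRightInvariant := by
  refine ⟨fun g => ?_⟩
  have : IsProbabilityMeasure ((haarO n).map (· * g)) :=
    Measure.isProbabilityMeasure_map (measurable_mul_const g).aemeasurable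
  exact Measure.isHaarMeasure_eq_of_isProbabilityMeasure _ _

lemma transpose_mul_self_coe (U : O n) :
    (U : Matrix (Fin n) (Fin n) ℝ)ᵀ * (U : Matrix (Fin n) (Fin n) ℝ) = 1 := by
  have := (Unitary.mem_iff.1 U.2).1
  rwa [star_eq_conjTranspose, conjTranspose_eq_transpose_of_trivial] at this

lemma coe_inv_eq_transpose (U : O n) :
    ((U⁻¹ : O n) : Matrix (Fin n) (Fin n) ℝ) = (U : Matrix (Fin n) (Fin n) ℝ)ᵀ := by
  rw [← conjTranspose_eq_transpose_of_trivial]; rfl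

lemma exists_coe_eq_of_transpose_mul_self {M : Matrix (Fin n) (Fin n) ℝ} (h : Mᵀ * M = 1) :
    ∃ U : O n, (U : Matrix (Fin n) (Fin n) ℝ) = M := by
  refine ⟨⟨M, ?_⟩, rfl⟩
  rw [mem_orthogonalGroup_iff']
  simpa [star_eq_conjTranspose] using h

variable (p : Fin n → Prop) [DecidablePred p]

/-- The orthogonal projection onto the image under `U` of the coordinate subspace. -/
def frameProj (U : Matrix (Fin n) (Fin n) ℝ) : Matrix (Fin n) (Fin n) ℝ :=
  U * coordProj p * Uᵀ

/-- The reflection in the coordinate subspace. -/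
def coordRefl : Matrix (Fin n) (Fin n) ℝ := coordProj p - (1 - coordProj p)

lemma coordRefl_transpose : (coordRefl p)ᵀ = coordRefl p := by
  simp [coordRefl, coordProj_transpose]

lemma coordRefl_mul_self : coordRefl p * coordRefl p = 1 := by
  have he := coordProj_mul_self p
  simp only [coordRefl, sub_mul, mul_sub, he, one_mul, mul_one]
  abel

lemma frameProj_coordRefl : frameProj p (coordRefl p) = coordProj p := by
  have he := coordProj_mul_self p
  rw [frameProj, coordRefl_transpose]
  simp only [coordRefl, sub_mul, mul_sub, he, one_mul, mul_one]
  abel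

lemma frameProj_mul (U V : Matrix (Fin n) (Fin n) ℝ) :
    frameProj p (U * V) = U * frameProj p V * Uᵀ := by
  simp only [frameProj, transpose_mul, mul_assoc]

lemma frameProj_transpose (U : Matrix (Fin n) (Fin n) ℝ) :
    (frameProj p U)ᵀ = frameProj p U := by
  simp only [frameProj, transpose_mul, transpose_transpose, coordProj_transpose, mul_assoc]

lemma continuous_frameProj : Continuous (frameProj p) := by
  unfold frameProj; fun_prop

/-- The orthogonal matrices close to the reflection in the coordinate subspace which move this
subspace by at most `r / 16`. -/
def nearRefl (r : ℝ) : Set (O n) :=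
  {U | ‖(U : Matrix (Fin n) (Fin n) ℝ) - coordRefl p‖ ≤ 1 / 16 ∧
    ‖frameProj p U - coordProj p‖ ≤ r / 16}

lemma measurableSet_nearRefl (r : ℝ) : MeasurableSet (nearRefl p r) := by
  have hc := continuous_frameProj p
  have h₁ : Continuous fun U : O n => ‖(U : Matrix (Fin n) (Fin n) ℝ) - coordRefl p‖ := by fun_prop
  have h₂ : Continuous fun U : O n => ‖frameProj p U - coordProj p‖ := by fun_prop
  exact ((isClosed_le h₁ continuous_const).inter (isClosed_le h₂ continuous_const)).measurableSet

/-- A doubling property of the invariant measure of the Grassmannian. -/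
lemma exists_measure_le_nearRefl : ∃ N : ℕ, ∀ r > 0, ∀ Q : Matrix (Fin n) (Fin n) ℝ,
    haarO n {U | ‖frameProj p U - Q‖ ≤ 5 * r} ≤ N * haarO n (nearRefl p r) := by
  obtain ⟨t₁, -, ht₁, hc₁⟩ := finite_cover_balls_of_compact
    (isCompact_closedBall (0 : Matrix (Fin n) (Fin n) ℝ) 5) (e := 1 / 32) (by norm_num)
  obtain ⟨t₂, -, ht₂, hc₂⟩ := finite_cover_balls_of_compact
    (isCompact_closedBall (0 : Matrix (Fin n) (Fin n) ℝ) ‖(1 : Matrix (Fin n) (Fin n) ℝ)‖)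
    (e := 1 / 32) (by norm_num)
  lift t₁ to Finset (Matrix (Fin n) (Fin n) ℝ) using ht₁
  lift t₂ to Finset (Matrix (Fin n) (Fin n) ℝ) using ht₂
  obtain ⟨J, hJ⟩ := exists_coe_eq_of_transpose_mul_self (M := coordRefl p)
    (by rw [coordRefl_transpose, coordRefl_mul_self])
  refine ⟨(t₁ ×ˢ t₂).card, fun r hr Q => ?_⟩
  -- The cells are small at scale `r` in the plane but at a fixed scale in `U`. After rescaling by
  -- `r`, the nets `t₁` and `t₂` depend on neither `r` nor `Q`, so neither does the number of cells.
  set S : Matrix (Fin n) (Fin n) ℝ × Matrix (Fin n) (Fin n) ℝ → Set (O n) := fun c =>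
    {U | ‖frameProj p U - Q - r • c.1‖ < r / 32 ∧ ‖(U : Matrix (Fin n) (Fin n) ℝ) - c.2‖ < 1 / 32}
    with hS
  have hcover : {U : O n | ‖frameProj p U - Q‖ ≤ 5 * r} ⊆ ⋃ c ∈ t₁ ×ˢ t₂, S c := by
    intro U hU
    have h1 : r⁻¹ • (frameProj p U - Q) ∈ Metric.closedBall (0 : Matrix (Fin n) (Fin n) ℝ) 5 := by
      rw [mem_closedBall_zero_iff, norm_smul, norm_inv, Real.norm_of_nonneg hr.le,
        inv_mul_le_iff₀ hr, mul_comm]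
      exact hU
    have h2 : (U : Matrix (Fin n) (Fin n) ℝ) ∈
        Metric.closedBall (0 : Matrix (Fin n) (Fin n) ℝ) ‖(1 : Matrix (Fin n) (Fin n) ℝ)‖ := by
      rw [mem_closedBall_zero_iff, ← frobenius_norm_orthogonal_mul (transpose_mul_self_coe U) 1,
        mul_one]
    obtain ⟨c₁, hc₁m, hc₁d⟩ := Set.mem_iUnion₂.1 (hc₁ h1)
    obtain ⟨c₂, hc₂m, hc₂d⟩ := Set.mem_iUnion₂.1 (hc₂ h2)
    refine Set.mem_iUnion₂.2 ⟨(c₁, c₂), Finset.mem_product.2 ⟨hc₁m, hc₂m⟩, ?_, ?_⟩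
    · rw [Metric.mem_ball, dist_eq_norm] at hc₁d
      have : frameProj p U - Q - r • c₁ = r • (r⁻¹ • (frameProj p U - Q) - c₁) := by
        rw [smul_sub, smul_smul, mul_inv_cancel₀ hr.ne', one_smul]
      change ‖frameProj p U - Q - r • c₁‖ < r / 32
      rw [this, norm_smul, Real.norm_of_nonneg hr.le]
      calc r * _ < r * (1 / 32) := mul_lt_mul_of_pos_left hc₁d hr
        _ = r / 32 := by ring
    · rw [Metric.mem_ball, dist_eq_norm] at hc₂d
      exact hc₂d
  have hcell (c) : haarO n (S c) ≤ haarO n (nearRefl p r) := by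
    rcases (S c).eq_empty_or_nonempty with h0 | ⟨U₀, hU₀⟩
    · simp [h0]
    -- The left translation taking `U₀` to the reflection `J` carries the whole cell into `nearRefl
    -- p r`.
    rw [← measure_preimage_mul (haarO n) (J * U₀⁻¹) (nearRefl p r)]
    refine measure_mono fun U hU => ?_
    set G : Matrix (Fin n) (Fin n) ℝ := ((J * U₀⁻¹ : O n) : Matrix (Fin n) (Fin n) ℝ) with hG
    have hGG : Gᵀ * G = 1 := transpose_mul_self_coe _
    have hGU : G * U₀ = coordRefl p := by
      rw [hG, ← hJ, ← Submonoid.coe_mul, mul_assoc, inv_mul_cancel, mul_one]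
    have hGt : Gᵀᵀ * Gᵀ = 1 := by rw [transpose_transpose]; exact mul_eq_one_comm.1 hGG
    have hco : ((J * U₀⁻¹ * U : O n) : Matrix (Fin n) (Fin n) ℝ) = G * U := rfl
    refine ⟨?_, ?_⟩
    · rw [hco, ← hGU, ← mul_sub, frobenius_norm_orthogonal_mul hGG]
      calc ‖(U : Matrix (Fin n) (Fin n) ℝ) - U₀‖
          = ‖((U : Matrix (Fin n) (Fin n) ℝ) - c.2) - (U₀ - c.2)‖ := by congr 1; abel
        _ ≤ 1 / 32 + 1 / 32 := (norm_sub_le _ _).trans (add_le_add hU.2.le hU₀.2.le)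
        _ = 1 / 16 := by norm_num
    · rw [hco, ← frameProj_coordRefl p, ← hGU, frameProj_mul, frameProj_mul, ← sub_mul, ← mul_sub,
        frobenius_norm_mul_orthogonal hGt, frobenius_norm_orthogonal_mul hGG]
      calc ‖frameProj p U - frameProj p U₀‖
          = ‖(frameProj p U - Q - r • c.1) - (frameProj p U₀ - Q - r • c.1)‖ := by
            congr 1; abel
        _ ≤ r / 32 + r / 32 := (norm_sub_le _ _).trans (add_le_add hU.1.le hU₀.1.le)
        _ = r / 16 := by ring
  calc haarO n {U | ‖frameProj p U - Q‖ ≤ 5 * r}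
      ≤ haarO n (⋃ c ∈ t₁ ×ˢ t₂, S c) := measure_mono hcover
    _ ≤ ∑ c ∈ t₁ ×ˢ t₂, haarO n (S c) := measure_biUnion_finset_le _ _
    _ ≤ ∑ _c ∈ t₁ ×ˢ t₂, haarO n (nearRefl p r) := Finset.sum_le_sum fun c _ => hcell c
    _ = _ := by rw [Finset.sum_const, nsmul_eq_mul]

lemma measure_preimage_mul_mul {G : Type*} [Group G] [MeasurableSpace G] [MeasurableMul G]
    (μ : Measure G) [μ.IsMulLeftInvariant] [μ.IsMulRightInvariant] (a b : G) (S : Set G) :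
    μ ((fun g => a * g * b) ⁻¹' S) = μ S := by
  have : (fun g => a * g * b) ⁻¹' S = (fun g => a * g) ⁻¹' ((fun g => g * b) ⁻¹' S) := rfl
  rw [this, measure_preimage_mul, measure_preimage_mul_right]

lemma countable_of_disjoint_closedBall {κ X : Type*} [MetricSpace X] [ProperSpace X] {u : Set κ}
    {x : κ → X} {r : κ → ℝ} (hu : u.PairwiseDisjoint fun a => Metric.closedBall (x a) (r a))
    (hr : ∀ a ∈ u, 0 < r a) : u.Countable :=
  hu.countable_of_nonempty_interior fun a ha =>
    ⟨x a, Metric.ball_subset_interior_closedBall (Metric.mem_ball_self (hr a ha))⟩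

/-- The invariant measure of an open set of subspaces is controlled by the probability that
`U * A` has an invariant subspace in that set. -/
lemma measure_frameProj_mem_le {N : ℕ} (hN : ∀ r > 0, ∀ Q : Matrix (Fin n) (Fin n) ℝ,
      haarO n {U | ‖frameProj p U - Q‖ ≤ 5 * r} ≤ N * haarO n (nearRefl p r))
    {A : Matrix (Fin n) (Fin n) ℝ} (hA : IsUnit A.det) {Ω : Set (Matrix (Fin n) (Fin n) ℝ)}
    (hΩ : ∀ Q ∈ Ω, ∃ δ > 0, Metric.ball Q δ ⊆ Ω) :
    haarO n {V | frameProj p V ∈ Ω} ≤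
      N * haarO n {U | ∃ V : O n, frameProj p V ∈ Ω ∧
        (1 - frameProj p V) * (U * A) * frameProj p V = 0} := by
  -- The condition on `Ω` sits inside the existential so that `choose` yields total functions;
  -- outside `Ω` the radius is a dummy `0`. The bound `r ≤ 1` serves Vitali's lemma.
  have hloc : ∀ V₀ : O n, ∃ (V W : O n) (r : ℝ), frameProj p V₀ ∈ Ω → 0 < r ∧ r ≤ 1 ∧
      Metric.closedBall (frameProj p V₀) r ⊆ Ω ∧
      ∀ U : O n, V⁻¹ * U * W ∈ nearRefl p r → ∃ V' : O n,
        frameProj p V' ∈ Metric.closedBall (frameProj p V₀) r ∧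
        IsSplitInvariant p (U * A) (frameProj p V') := by
    intro V₀
    obtain ⟨V, W, hV, hW, r₀, hr₀, h⟩ :=
      exists_split_invariant_near p hA (transpose_mul_self_coe V₀)
    obtain ⟨V, rfl⟩ := exists_coe_eq_of_transpose_mul_self hV
    obtain ⟨W, rfl⟩ := exists_coe_eq_of_transpose_mul_self hW
    by_cases hmem : frameProj p V₀ ∈ Ω
    · obtain ⟨δ, hδ, hball⟩ := hΩ _ hmem
      refine ⟨V, W, min (min r₀ 1) (δ / 2), fun _ => ⟨by positivity,
        (min_le_left _ _).trans (min_le_right _ _), (Metric.closedBall_subset_ball ?_).trans hball,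
        fun U hU => ?_⟩⟩
      · exact (min_le_right _ _).trans_lt (by linarith)
      · have hco : ((V⁻¹ * U * W : O n) : Matrix (Fin n) (Fin n) ℝ) =
            (V : Matrix (Fin n) (Fin n) ℝ)ᵀ * U * W := by
          rw [← coe_inv_eq_transpose]; rfl
        obtain ⟨hU1, hU2⟩ := hU
        rw [hco] at hU1 hU2
        obtain ⟨V', hV', hd, hs⟩ := h _ (by positivity) ((min_le_left _ _).trans (min_le_left _ _))
          U (transpose_mul_self_coe U) hU1 hU2
        obtain ⟨V', rfl⟩ := exists_coe_eq_of_transpose_mul_self hV'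
        exact ⟨V', by rw [Metric.mem_closedBall, dist_eq_norm]; exact hd, hs⟩
    · exact ⟨V, W, 0, fun h => absurd h hmem⟩
  choose V W r h using hloc
  set t : Set (O n) := {V | frameProj p V ∈ Ω} with ht
  obtain ⟨u, hut, hdisj, hcov⟩ := Vitali.exists_disjoint_subfamily_covering_enlargement_closedBall
    t (fun V₀ : O n => frameProj p V₀) r 1 (fun a ha => (h a ha).2.1) 5 (by norm_num)
  have hucount : u.Countable := by
    exact countable_of_disjoint_closedBall hdisj fun a ha => (h a (hut ha)).1
  set E : O n → Set (O n) := fun a => (fun U => (V a)⁻¹ * U * W a) ⁻¹' nearRefl p (r a) with hE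
  have hEmeas (a) : MeasurableSet (E a) :=
    (by fun_prop : Continuous fun U => (V a)⁻¹ * U * W a).measurable (measurableSet_nearRefl p _)
  have hEvol (a) : haarO n (E a) = haarO n (nearRefl p (r a)) := measure_preimage_mul_mul _ _ _ _
  -- A common `U` would give `U * A` split invariant subspaces in two disjoint balls, contrary to
  -- uniqueness.
  have hEdisj : u.PairwiseDisjoint E := by
    intro a ha b hb hab
    refine Set.disjoint_left.2 fun U hUa hUb => ?_
    obtain ⟨Va, hVa, hsa⟩ := (h a (hut ha)).2.2.2 U hUa
    obtain ⟨Vb, hVb, hsb⟩ := (h b (hut hb)).2.2.2 U hUb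
    have := hsa.unique hsb (frameProj_transpose p _) (frameProj_transpose p _)
    rw [← this] at hVb
    exact Set.disjoint_left.1 (hdisj ha hb hab) hVa hVb
  have htcov : t ⊆ ⋃ b ∈ u, {U : O n | ‖frameProj p U - frameProj p b‖ ≤ 5 * r b} := by
    intro a ha
    obtain ⟨b, hb, hsub⟩ := hcov a ha
    have := hsub (Metric.mem_closedBall_self (h a ha).1.le)
    rw [Metric.mem_closedBall, dist_eq_norm] at this
    exact Set.mem_iUnion₂.2 ⟨b, hb, this⟩
  calc haarO n t ≤ haarO n (⋃ b ∈ u, {U : O n | ‖frameProj p U - frameProj p b‖ ≤ 5 * r b}) :=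
        measure_mono htcov
    _ ≤ ∑' b : u, haarO n {U : O n | ‖frameProj p U - frameProj p b‖ ≤ 5 * r b} :=
        measure_biUnion_le _ hucount _
    _ ≤ ∑' b : u, N * haarO n (E b) := by
        refine ENNReal.tsum_le_tsum fun b => ?_
        rw [hEvol]
        exact hN _ (h b (hut b.2)).1 _
    _ = N * haarO n (⋃ b ∈ u, E b) := by
        rw [ENNReal.tsum_mul_left, measure_biUnion hucount hEdisj fun b _ => hEmeas b]
    _ ≤ _ := by
        gcongr
        refine Set.iUnion₂_subset fun b hb U hU => ?_
        obtain ⟨V', hV', hs⟩ := (h b (hut hb)).2.2.2 U hU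
        exact ⟨V', (h b (hut hb)).2.2.1 hV', hs.invariant⟩

end Covering

/-! ### Subspaces and volume factors in terms of projections -/

section Frame

variable {n k : ℕ}

/-- The first `k` coordinates. -/
abbrev firstCoords (n k : ℕ) : Fin n → Prop := fun i => (i : ℕ) < k

lemma euclMap_apply (A : GL (Fin n) ℝ) (x : E n) :
    (euclMap A x).ofLp = (A : Matrix (Fin n) (Fin n) ℝ) *ᵥ x.ofLp :=
  ofLp_toEuclideanCLM _ _

lemma coe_toGL (U : O n) :
    ((O.toGL U : GL (Fin n) ℝ) : Matrix (Fin n) (Fin n) ℝ) = (U : Matrix (Fin n) (Fin n) ℝ) := rfl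

lemma coordProj_mulVec_of_mem_base (hk : k ≤ n) {x : E n} (hx : x ∈ (Grass.base hk).1) :
    coordProj (firstCoords n k) *ᵥ x.ofLp = x.ofLp := by
  induction hx using Submodule.span_induction with
  | mem x hx =>
    obtain ⟨i, rfl⟩ := hx
    ext j
    simp only [coordProj, mulVec_diagonal, EuclideanSpace.single, PiLp.ofLp_single]
    by_cases h : j = Fin.castLE hk i
    · subst h; simp [firstCoords]
    · simp [h]
  | zero => simp
  | add x y _ _ hx hy => simp [mulVec_add, hx, hy]
  | smul c x _ hx => simp [mulVec_smul, hx]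

lemma coordProj_mulVec_mem_base (hk : k ≤ n) (w : Fin n → ℝ) :
    WithLp.toLp 2 (coordProj (firstCoords n k) *ᵥ w) ∈ (Grass.base hk).1 := by
  have h : WithLp.toLp 2 (coordProj (firstCoords n k) *ᵥ w) =
      ∑ i : Fin k, w (Fin.castLE hk i) • EuclideanSpace.single (Fin.castLE hk i) (1 : ℝ) := by
    ext j
    simp only [coordProj, mulVec_diagonal, WithLp.ofLp_sum, Finset.sum_apply, WithLp.ofLp_smul,
      Pi.smul_apply, EuclideanSpace.single, PiLp.ofLp_single, smul_eq_mul, Pi.single_apply]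
    by_cases hj : (j : ℕ) < k
    · rw [Finset.sum_eq_single ⟨j, hj⟩]
      · simp [firstCoords, hj]
      · intro b _ hb
        have : j ≠ Fin.castLE hk b := fun h => hb (by ext; simp [h])
        simp [this]
      · simp
    · rw [Finset.sum_eq_zero]
      · simp [firstCoords, hj]
      · intro b _
        have : j ≠ Fin.castLE hk b := fun h => hj (by rw [h]; exact b.2)
        simp [this]
  rw [h]
  exact Submodule.sum_mem _ fun i _ =>
    Submodule.smul_mem _ _ (Submodule.subset_span ⟨i, rfl⟩)

lemma frameProj_mulVec_of_mem (hk : k ≤ n) (U : O n) {y : E n}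
    (hy : y ∈ (O.toGL U • Grass.base hk).1) :
    frameProj (firstCoords n k) U *ᵥ y.ofLp = y.ofLp := by
  obtain ⟨x, hx, rfl⟩ := hy
  rw [euclMap_apply, coe_toGL, frameProj, mulVec_mulVec, Matrix.mul_assoc, transpose_mul_self_coe,
    Matrix.mul_one, ← mulVec_mulVec, coordProj_mulVec_of_mem_base hk hx]

lemma frameProj_mulVec_mem (hk : k ≤ n) (U : O n) (w : Fin n → ℝ) :
    WithLp.toLp 2 (frameProj (firstCoords n k) U *ᵥ w) ∈ (O.toGL U • Grass.base hk).1 := by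
  refine ⟨_, coordProj_mulVec_mem_base hk ((U : Matrix (Fin n) (Fin n) ℝ)ᵀ *ᵥ w), ?_⟩
  ext j
  rw [euclMap_apply, coe_toGL, frameProj, mulVec_mulVec, mulVec_mulVec, Matrix.mul_assoc]

/-- A subspace is invariant if its orthogonal projection satisfies the corresponding equation. -/
lemma smul_frame_eq (hk : k ≤ n) (A : GL (Fin n) ℝ) (U : O n)
    (h : (1 - frameProj (firstCoords n k) U) * (A : Matrix (Fin n) (Fin n) ℝ) *
      frameProj (firstCoords n k) U = 0) :
    A • (O.toGL U • Grass.base hk) = O.toGL U • Grass.base hk := by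
  refine Subtype.ext (Submodule.eq_of_le_of_finrank_eq ?_
    ((A • (O.toGL U • Grass.base hk)).2.trans (O.toGL U • Grass.base hk).2.symm))
  rintro _ ⟨y, hy, rfl⟩
  have h1 := frameProj_mulVec_of_mem hk U hy
  set P := frameProj (firstCoords n k) (U : Matrix (Fin n) (Fin n) ℝ)
  have h2 : P *ᵥ ((A : Matrix (Fin n) (Fin n) ℝ) *ᵥ y.ofLp) =
      (A : Matrix (Fin n) (Fin n) ℝ) *ᵥ y.ofLp := by
    have h3 : P * A * P = A * P := by
      rw [sub_mul, sub_mul, Matrix.one_mul, sub_eq_zero] at h; exact h.symm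
    conv_lhs => rw [← h1, mulVec_mulVec, mulVec_mulVec, h3]
    rw [← mulVec_mulVec, h1]
  have h4 := frameProj_mulVec_mem hk U ((A : Matrix (Fin n) (Fin n) ℝ) *ᵥ y.ofLp)
  rw [h2] at h4
  exact h4

/-- The volume factor of `A` on the range of the orthogonal projection `P`. -/
def projDet (A P : Matrix (Fin n) (Fin n) ℝ) : ℝ :=
  √(1 - P + P * (Aᵀ * A) * P).det

/-- Padding by `1 - P` keeps the determinant of size `n`, so it is polynomial in the entries and
requires no choice of basis of the subspace. -/
lemma continuous_projDet : Continuous fun q : Matrix (Fin n) (Fin n) ℝ × Matrix (Fin n) (Fin n) ℝ =>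
    projDet q.1 q.2 := by
  unfold projDet; fun_prop

/-- Only `Aᵀ * A` enters. The superlevel sets of the volume factor are therefore the same along the
whole orbit of `A`. -/
lemma projDet_orthogonal_mul (U : O n) (A P : Matrix (Fin n) (Fin n) ℝ) :
    projDet ((U : Matrix (Fin n) (Fin n) ℝ) * A) P = projDet A P := by
  rw [projDet, projDet, transpose_mul, Matrix.mul_assoc Aᵀ, ← Matrix.mul_assoc _ _ A,
    transpose_mul_self_coe, Matrix.one_mul]

/-- Conjugation by `U` makes the padded matrix block diagonal, with an identity block on the last
coordinates. -/
lemma det_frame_eq (hk : k ≤ n) (U : O n) (H : Matrix (Fin n) (Fin n) ℝ) :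
    (1 - frameProj (firstCoords n k) U + frameProj (firstCoords n k) U * H *
      frameProj (firstCoords n k) U).det =
    (((U : Matrix (Fin n) (Fin n) ℝ)ᵀ * H * U).submatrix (Fin.castLE hk) (Fin.castLE hk)).det := by
  set e := coordProj (firstCoords n k) with he
  set V : Matrix (Fin n) (Fin n) ℝ := (U : Matrix (Fin n) (Fin n) ℝ) with hV
  have hVV : Vᵀ * V = 1 := transpose_mul_self_coe U
  have hVV' : V * Vᵀ = 1 := mul_eq_one_comm.1 hVV
  set G := Vᵀ * H * V with hG
  have h1 : 1 - frameProj (firstCoords n k) V + frameProj (firstCoords n k) V * H *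
      frameProj (firstCoords n k) V = V * (1 - e + e * G * e) * Vᵀ := by
    simp only [frameProj, hG, mul_add, add_mul, mul_sub, sub_mul, mul_one, hVV', ← he]
    simp only [mul_assoc]
  have h2 : (1 - e + e * G * e).det = ((1 - e + e * G * e).toSquareBlockProp (firstCoords n k)).det *
      ((1 - e + e * G * e).toSquareBlockProp fun i => ¬ firstCoords n k i).det := by
    refine twoBlockTriangular_det _ _ fun i hi j hj => ?_
    have hij : i ≠ j := fun h => hi (h ▸ hj)
    simp [he, coordProj, hi, hij]
  have h3 : ((1 - e + e * G * e).toSquareBlockProp fun i => ¬ firstCoords n k i) = 1 := by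
    ext i j
    have hi : ¬ ((i : Fin n) : ℕ) < k := i.2
    simp [toSquareBlockProp, he, coordProj, diagonal_apply, hi, -not_lt, one_apply, Subtype.ext_iff]
  have h4 : ((1 - e + e * G * e).toSquareBlockProp (firstCoords n k)).det =
      (G.submatrix (Fin.castLE hk) (Fin.castLE hk)).det := by
    set σ : Fin k ≃ {i : Fin n // firstCoords n k i} :=
      { toFun := fun i => ⟨Fin.castLE hk i, i.2⟩
        invFun := fun i => ⟨i.1, i.2⟩
        left_inv := fun i => rfl
        right_inv := fun i => rfl }
    rw [← det_submatrix_equiv_self σ]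
    congr 1
    ext i j
    simp [toSquareBlockProp, he, coordProj, diagonal_apply, one_apply, σ, Matrix.sub_apply]
  rw [h1, det_mul_right_comm, hVV', Matrix.one_mul, h2, h3, h4, det_one, mul_one]

/-- The first `k` columns of `U` are an orthonormal basis of the subspace; in it, the adjoint
composition has as its matrix the Gram matrix of the images under `A`. -/
lemma absDet_frame (hk : k ≤ n) (A : GL (Fin n) ℝ) (U : O n) :
    absDet A (O.toGL U • Grass.base hk) =
      projDet (A : Matrix (Fin n) (Fin n) ℝ) (frameProj (firstCoords n k) U) := by
  rw [absDet, projDet, det_frame_eq hk]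
  congr 1
  set g := (O.toGL U • Grass.base hk) with hg
  set V : Matrix (Fin n) (Fin n) ℝ := (U : Matrix (Fin n) (Fin n) ℝ) with hV
  have hmem (i : Fin k) : euclMap (O.toGL U) (EuclideanSpace.single (Fin.castLE hk i) (1 : ℝ)) ∈ g.1 :=
    ⟨_, Submodule.subset_span ⟨i, rfl⟩, rfl⟩
  set v : Fin k → g.1 := fun i => ⟨_, hmem i⟩ with hv
  have hcol (B : GL (Fin n) ℝ) (i : Fin n) :
      (euclMap B (EuclideanSpace.single i (1 : ℝ))).ofLp = (B : Matrix (Fin n) (Fin n) ℝ).col i := by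
    rw [euclMap_apply]; simp [EuclideanSpace.single]
  have hinner (B : GL (Fin n) ℝ) (i j : Fin n) :
      inner ℝ (euclMap B (EuclideanSpace.single i (1 : ℝ))) (euclMap B (EuclideanSpace.single j 1)) =
        ((B : Matrix (Fin n) (Fin n) ℝ)ᵀ * (B : Matrix (Fin n) (Fin n) ℝ)) i j := by
    rw [EuclideanSpace.inner_eq_star_dotProduct, hcol, hcol]
    simp [Matrix.mul_apply, dotProduct, mul_comm]
  have hon : Orthonormal ℝ v := by
    rw [orthonormal_iff_ite]
    intro i j
    have h := hinner (O.toGL U) (Fin.castLE hk i) (Fin.castLE hk j)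
    rw [coe_toGL, transpose_mul_self_coe] at h
    rw [Submodule.coe_inner, hv]
    simp only [h, one_apply, (Fin.castLE_injective hk).eq_iff]
  have hspan : Submodule.span ℝ (Set.range v) = ⊤ :=
    hon.linearIndependent.span_eq_top_of_card_eq_finrank' (by rw [g.2, Fintype.card_fin])
  set b := OrthonormalBasis.mk hon hspan.ge with hb
  rw [← LinearMap.det_toMatrix b.toBasis]
  congr 1
  ext i j
  have hAU := hinner (A * O.toGL U) (Fin.castLE hk i) (Fin.castLE hk j)
  rw [euclMap_mul] at hAU
  rw [LinearMap.toMatrix_apply, OrthonormalBasis.coe_toBasis_repr_apply,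
    OrthonormalBasis.repr_apply_apply, OrthonormalBasis.coe_toBasis, LinearMap.comp_apply,
    LinearMap.adjoint_inner_right, hb, OrthonormalBasis.coe_mk]
  refine Eq.trans ?_ (hAU.trans ?_)
  · rfl
  · rw [Units.val_mul, coe_toGL, transpose_mul, submatrix_apply]
    simp only [Matrix.mul_assoc, hV]

end Frame

/-! ### Integration over orbits and over `μ` -/

section Integration

variable {n : ℕ} (p : Fin n → Prop) [DecidablePred p]

instance instSecondCountableTopologyMatrix :
    SecondCountableTopology (Matrix (Fin n) (Fin n) ℝ) :=
  inferInstanceAs (SecondCountableTopology (Fin n → Fin n → ℝ))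

instance instSecondCountableTopologyO : SecondCountableTopology (O n) :=
  Topology.IsEmbedding.subtypeVal.secondCountableTopology

/-- The largest value of `log⁺ |det A|_g|` over the invariant subspaces `g` of `A` that are images
of the coordinate subspace under orthogonal matrices. -/
def supInvariant (A : GL (Fin n) ℝ) : ℝ≥0∞ :=
  ⨆ (V : O n) (_ : (1 - frameProj p V) * (A : Matrix (Fin n) (Fin n) ℝ) * frameProj p V = 0),
    ENNReal.ofReal (posLog (projDet (A : Matrix (Fin n) (Fin n) ℝ) (frameProj p V)))

/-- The supremum runs over an uncountable set, but the conditions are closed in the pair `(V, A)`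
and projection along the compact group `O n` preserves closedness. Superlevel sets are thus
countable unions of closed sets. -/
lemma measurable_supInvariant : Measurable (supInvariant p) := by
  have hP : Continuous fun q : O n × GL (Fin n) ℝ => frameProj p (q.1 : Matrix (Fin n) (Fin n) ℝ) :=
    (continuous_frameProj p).comp (continuous_subtype_val.comp continuous_fst)
  have hA : Continuous fun q : O n × GL (Fin n) ℝ => (q.2 : Matrix (Fin n) (Fin n) ℝ) :=
    Units.continuous_val.comp continuous_snd
  have hclosed (c : ℝ≥0∞) : IsClosed {A : GL (Fin n) ℝ | ∃ V : O n,
      (1 - frameProj p V) * (A : Matrix (Fin n) (Fin n) ℝ) * frameProj p V = 0 ∧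
      c ≤ ENNReal.ofReal (posLog (projDet (A : Matrix (Fin n) (Fin n) ℝ) (frameProj p V)))} := by
    have h : IsClosed {q : O n × GL (Fin n) ℝ |
        (1 - frameProj p q.1) * (q.2 : Matrix (Fin n) (Fin n) ℝ) * frameProj p q.1 = 0 ∧
        c ≤ ENNReal.ofReal (posLog (projDet (q.2 : Matrix (Fin n) (Fin n) ℝ) (frameProj p q.1)))} :=
      (isClosed_eq (((continuous_const.sub hP).mul hA).mul hP) continuous_const).inter
        (isClosed_le continuous_const (ENNReal.continuous_ofReal.comp
          (continuous_posLog.comp (continuous_projDet.comp (hA.prodMk hP)))))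
    convert isClosedMap_snd_of_compactSpace _ h using 1
    ext A
    simp
  refine measurable_of_Ioi fun t => ?_
  have : supInvariant p ⁻¹' Set.Ioi t = ⋃ (q : ℚ) (_ : t < ((q : ℝ).toNNReal : ℝ≥0∞)),
      {A : GL (Fin n) ℝ | ∃ V : O n,
      (1 - frameProj p V) * (A : Matrix (Fin n) (Fin n) ℝ) * frameProj p V = 0 ∧
      ((q : ℝ).toNNReal : ℝ≥0∞) ≤
        ENNReal.ofReal (posLog (projDet (A : Matrix (Fin n) (Fin n) ℝ) (frameProj p V)))} := by
    ext A
    simp only [supInvariant, Set.mem_preimage, Set.mem_Ioi, lt_iSup_iff, Set.mem_iUnion,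
      Set.mem_ofPred_eq, exists_prop]
    constructor
    · rintro ⟨V, hV, hlt⟩
      obtain ⟨q, -, h1, h2⟩ := ENNReal.lt_iff_exists_rat_btwn.1 hlt
      exact ⟨q, h1, V, hV, h2.le⟩
    · rintro ⟨q, h1, V, hV, h2⟩
      exact ⟨V, hV, h1.trans_le h2⟩
  rw [this]
  exact MeasurableSet.iUnion fun q => MeasurableSet.iUnion fun _ => (hclosed _).measurableSet

lemma continuous_toGL : Continuous (O.toGL : O n → GL (Fin n) ℝ) := by
  refine Units.continuous_iff.2 ⟨continuous_subtype_val, ?_⟩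
  exact continuous_star.comp continuous_subtype_val

lemma continuous_toGL_mul : Continuous fun q : GL (Fin n) ℝ × O n => O.toGL q.2 * q.1 :=
  (continuous_toGL.comp continuous_snd).mul continuous_fst

lemma measurable_toGL_mul : Measurable fun q : GL (Fin n) ℝ × O n => O.toGL q.2 * q.1 :=
  continuous_toGL_mul.measurable

open scoped Matrix.Norms.Frobenius in
lemma exists_ball_subset_of_continuous {f : Matrix (Fin n) (Fin n) ℝ → ℝ} (hf : Continuous f)
    (t : ℝ) (Q : Matrix (Fin n) (Fin n) ℝ) (hQ : t < f Q) :
    ∃ δ > 0, Metric.ball Q δ ⊆ {Q | t < f Q} :=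
  Metric.isOpen_iff.1 (isOpen_lt continuous_const hf) Q hQ

/-- The inequality for a single orbit `O_n(ℝ) A`. -/
lemma lintegral_frame_le {N : ℕ} (hN : ∀ (A : Matrix (Fin n) (Fin n) ℝ), IsUnit A.det →
      ∀ f : Matrix (Fin n) (Fin n) ℝ → ℝ, Continuous f → ∀ t : ℝ,
      haarO n {V | t < f (frameProj p V)} ≤
        N * haarO n {U | ∃ V : O n, t < f (frameProj p V) ∧
        (1 - frameProj p V) * (U * A) * frameProj p V = 0}) (A : GL (Fin n) ℝ) :
    ∫⁻ V : O n, ENNReal.ofReal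
        (posLog (projDet (A : Matrix (Fin n) (Fin n) ℝ) (frameProj p V))) ∂haarO n ≤
      N * ∫⁻ U : O n, supInvariant p (O.toGL U * A) ∂haarO n := by
  set f : Matrix (Fin n) (Fin n) ℝ → ℝ := fun Q => posLog (projDet (A : Matrix (Fin n) (Fin n) ℝ) Q)
    with hf_def
  have hf : Continuous f :=
    continuous_posLog.comp (continuous_projDet.comp (continuous_const.prodMk continuous_id))
  have hfc : Continuous fun V : O n => f (frameProj p V) :=
    hf.comp ((continuous_frameProj p).comp continuous_subtype_val)
  have hf0 (Q) : 0 ≤ f Q := posLog_nonneg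
  obtain ⟨M, hM⟩ : ∃ M, ∀ V : O n, f (frameProj p V) ≤ M := by
    obtain ⟨M, hM⟩ := (isCompact_range hfc).bddAbove
    exact ⟨M, fun V => hM ⟨V, rfl⟩⟩
  set F : O n → ℝ≥0∞ := fun U => supInvariant p (O.toGL U * A) with hF_def
  have hF : Measurable F :=
    (measurable_supInvariant p).comp (measurable_toGL_mul.comp measurable_prodMk_left)
  -- The layer-cake formula is for real-valued functions, so `F` is truncated at a bound `M` of `f`;
  -- no superlevel set of `f` is lost.
  set b : O n → ℝ := fun U => (min (F U) (ENNReal.ofReal M)).toReal with hb_def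
  have hb : Measurable b := (hF.min measurable_const).ennreal_toReal
  have hbF (U) : ENNReal.ofReal (b U) ≤ F U :=
    ENNReal.ofReal_toReal_le.trans (min_le_left _ _)
  have hsub (t : ℝ) : {U : O n | ∃ V : O n, t < f (frameProj p V) ∧
      (1 - frameProj p V) * (U * A) * frameProj p V = 0} ⊆ {U | t < b U} := by
    rintro U ⟨V, hV, hinv⟩
    refine hV.trans_le ?_
    rw [hb_def, ← ENNReal.ofReal_le_iff_le_toReal (by simp)]
    refine le_min ?_ (ENNReal.ofReal_le_ofReal (hM V))
    have : f (frameProj p V) =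
        posLog (projDet ((O.toGL U * A : GL (Fin n) ℝ) : Matrix (Fin n) (Fin n) ℝ)
          (frameProj p V)) := by
      rw [Units.val_mul, coe_toGL, projDet_orthogonal_mul]
    rw [this]
    exact le_iSup₂_of_le (f := fun (V : O n) (_ : (1 - frameProj p V) *
      ((O.toGL U * A : GL (Fin n) ℝ) : Matrix (Fin n) (Fin n) ℝ) * frameProj p V = 0) =>
      ENNReal.ofReal (posLog (projDet ((O.toGL U * A : GL (Fin n) ℝ) : Matrix (Fin n) (Fin n) ℝ)
        (frameProj p V)))) V hinv le_rfl
  have hAdet : IsUnit (A : Matrix (Fin n) (Fin n) ℝ).det :=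
    (Matrix.isUnit_iff_isUnit_det _).1 A.isUnit
  calc ∫⁻ V : O n, ENNReal.ofReal (f (frameProj p V)) ∂haarO n
      = ∫⁻ t in Set.Ioi (0 : ℝ), haarO n {V | t < f (frameProj p V)} :=
        lintegral_eq_lintegral_meas_lt _ (.of_forall fun V => hf0 _) hfc.measurable.aemeasurable
    _ ≤ ∫⁻ t in Set.Ioi (0 : ℝ), N * haarO n {U | t < b U} := by
        refine lintegral_mono fun t => (hN A hAdet f hf t).trans ?_
        exact mul_le_mul_right (measure_mono (hsub t)) _
    _ = N * ∫⁻ t in Set.Ioi (0 : ℝ), haarO n {U | t < b U} :=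
        lintegral_const_mul' _ _ (ENNReal.natCast_ne_top N)
    _ = N * ∫⁻ U, ENNReal.ofReal (b U) ∂haarO n := by
        rw [lintegral_eq_lintegral_meas_lt _ (.of_forall fun U => ENNReal.toReal_nonneg)
          hb.aemeasurable]
    _ ≤ N * ∫⁻ U, F U ∂haarO n := by
        gcongr with U
        exact hbF U

/-- The inequality for a fixed dimension `k`. -/
lemma exists_lintegral_le {n k : ℕ} (hk : k ≤ n) : ∃ N : ℕ,
    ∀ (μ : Measure (GL (Fin n) ℝ)) [IsProbabilityMeasure μ], IsOrthogonallyInvariant μ →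
      ∫⁻ A, ∫⁻ g, logPlusDet A g ∂(grassMeasure hk) ∂μ ≤
        N * ∫⁻ A, (⨆ (g : Grass n k) (_ : A • g = g), logPlusDet A g) ∂μ := by
  set p := firstCoords n k
  obtain ⟨N, hN⟩ := exists_measure_le_nearRefl p
  refine ⟨N, fun μ _ hμ => ?_⟩
  have horbit := lintegral_frame_le p (N := N) fun A hA f hf t =>
    measure_frameProj_mem_le p hN hA (Ω := {Q | t < f Q})
      (fun Q hQ => exists_ball_subset_of_continuous hf t Q hQ)
  have hm := measurable_supInvariant p
  have hmul := measurable_toGL_mul (n := n)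
  calc ∫⁻ A, ∫⁻ g, logPlusDet A g ∂(grassMeasure hk) ∂μ
      ≤ ∫⁻ A, N * ∫⁻ U : O n, supInvariant p (O.toGL U * A) ∂haarO n ∂μ := by
        -- The inequality for integrals against an image measure suffices here, so measurability of
        -- `logPlusDet` in `g` is not needed.
        refine lintegral_mono fun A => (lintegral_map_le _ _).trans ((horbit A).trans' ?_)
        refine lintegral_mono fun U => ?_
        rw [logPlusDet, absDet_frame hk]
    _ = N * ∫⁻ A, ∫⁻ U : O n, supInvariant p (O.toGL U * A) ∂haarO n ∂μ :=
        lintegral_const_mul' _ _ (ENNReal.natCast_ne_top N)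
    _ = N * ∫⁻ U : O n, ∫⁻ A, supInvariant p (O.toGL U * A) ∂μ ∂haarO n := by
        rw [lintegral_lintegral_swap (f := fun A (U : O n) => supInvariant p (O.toGL U * A))
          (hm.comp hmul).aemeasurable]
    _ = N * ∫⁻ _ : O n, ∫⁻ A, supInvariant p A ∂μ ∂haarO n := by
        congr 1
        refine lintegral_congr fun U => ?_
        conv_rhs => rw [← hμ U]
        exact (lintegral_map hm (hmul.comp measurable_prodMk_right)).symm
    _ = N * ∫⁻ A, supInvariant p A ∂μ := by simp
    _ ≤ N * ∫⁻ A, (⨆ (g : Grass n k) (_ : A • g = g), logPlusDet A g) ∂μ := by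
        gcongr with A
        refine iSup₂_le fun V hV => ?_
        rw [← absDet_frame hk]
        exact le_iSup₂_of_le (f := fun (g : Grass n k) (_ : A • g = g) => logPlusDet A g)
          (O.toGL V • Grass.base hk) (smul_frame_eq hk A V hV) le_rfl

end Integration

end OrthInv

end

theorem theorem3 (n : ℕ) :
    ∃ c : ℝ≥0, 0 < c ∧
      ∀ (k : ℕ) (hk : k ≤ n) (μ : Measure (GL (Fin n) ℝ)) [IsProbabilityMeasure μ],
        OrthInv.IsOrthogonallyInvariant μ →
          (c : ℝ≥0∞) * ∫⁻ A, ∫⁻ g, OrthInv.logPlusDet A g ∂(OrthInv.grassMeasure hk) ∂μ ≤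
            ∫⁻ A, (⨆ (g : OrthInv.Grass n k) (_ : A • g = g), OrthInv.logPlusDet A g) ∂μ := by
  choose N hN using fun k : Fin (n + 1) =>
    OrthInv.exists_lintegral_le (Nat.lt_succ_iff.1 k.2)
  -- The sum over the finitely many dimensions dominates each `N k`, and the added `1` keeps the
  -- inverse meaningful if all of them vanish.
  refine ⟨(∑ k, (N k : ℝ≥0) + 1)⁻¹, by positivity, fun k hk μ _ hμ => ?_⟩
  have h := hN ⟨k, Nat.lt_succ_iff.2 hk⟩ μ hμ
  have hne : (∑ k, (N k : ℝ≥0) + 1) ≠ 0 := by positivity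
  rw [ENNReal.coe_inv hne, ENNReal.inv_mul_le_iff (by exact_mod_cast hne) ENNReal.coe_ne_top]
  refine h.trans ?_
  gcongr
  have : (N ⟨k, Nat.lt_succ_iff.2 hk⟩ : ℝ≥0) ≤ ∑ k, (N k : ℝ≥0) + 1 :=
    (Finset.single_le_sum (f := fun k => (N k : ℝ≥0)) (fun _ _ => zero_le)
      (Finset.mem_univ _)).trans (le_add_of_nonneg_right zero_le_one)
  exact_mod_cast this
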